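/- All graphs are finite and simple. For a graph $G$ let $i_G(t)$ be the number of independent sets of $G$ with exactly $t$ vertices and $\alpha(G)$ the size of a largest independent set. The independent set sequence of $G$ is $(i_G(t))_{t=0}^{\alpha(G)}$, i.e. the coefficient sequence of the independence polynomial of $G$. A finite real sequence $(a_0,\dots,a_N)$ is log-concave if $a_k^2\ge a_{k-1}a_{k+1}$ for $1\le k\le N-1$, and unimodal if $a_0\le\dots\le a_m\ge\dots\ge a_N$ for some $0\le m\le N$. For a graph $G$ with distinguished adjacent vertices $v,w$ and $n\ge 0$, the $n$-concatenation $G^n(v,w)$ is obtained from $n$ vertex-disjoint copies of $G$, with distinguished vertices $v_1,w_1,\dots,v_n,w_n$, by adding the $n-1$ edges $w_1v_2,w_2v_3,\dots,w_{n-1}v_n$ (no edges if $n\le 1$; $G^0(v,w)$ is the empty graph). **Theorem 1.8.** For each of the following trees $T$ with distinguished vertices $v$ and $w$, the independent set sequence of $T^n(v,w)$ is log-concave and unimodal for all $n\ge 0$. 1. $T=S_{\ell_1,\ell_2}$, with $\ell_1,\ell_2\ge 0$ arbitrary, is the double star consisting of adjacent vertices $v$ and $w$, with $\ell_1$ pendant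 edges attached at $v$ and $\ell_2$ pendant edges attached at $w$. In this case $T^n(v,w)$ is isomorphic to a path on $2n$ vertices with $\ell_1$ and $\ell_2$ pendant edges attached alternately at its vertices ($\ell_1$ at the first vertex, $\ell_2$ at the second, $\ell_1$ at the third, and so on). 2. $T=P_k$ is a path on $k$ vertices, $1\le k\le 5000$, $w$ is a leaf of $T$ and $v$ is its unique neighbour (for $k=1$ there is no such pair $v,w$, and nothing is claimed). In this case $T^n(v,w)$ is isomorphic to a path on $2n$ vertices with a path of length $k-2$ (that is, with $k-2$ edges) attached by one of its ends at every second vertex of the path, beginning with the first. -/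

import Mathlib

/-- The term `i_G(t)` of the independent set sequence: the number of independent sets of
`G` with exactly `t` vertices. -/
noncomputable def indepSetCount {V : Type*} [Fintype V] (G : SimpleGraph V) (t : ℕ) : ℕ := by
  classical exact (G.indepSetFinset t).card

/-- The finite sequence `(a 0, …, a N)` of real numbers is log-concave. -/
def LogConcaveSeq (a : ℕ → ℝ) (N : ℕ) : Prop :=
  ∀ k : ℕ, 1 ≤ k → k < N → a (k - 1) * a (k + 1) ≤ a k ^ 2

/-- The finite sequence `(a 0, …, a N)` of real numbers is unimodal. -/
def UnimodalSeq (a : ℕ → ℝ) (N : ℕ) : Prop :=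
  ∃ m : ℕ, m ≤ N ∧ (∀ k : ℕ, k < m → a k ≤ a (k + 1)) ∧
    (∀ k : ℕ, m ≤ k → k < N → a (k + 1) ≤ a k)

/-- The independent set sequence `(i_G(0), …, i_G(α(G)))` is log-concave, where
`α(G) = G.indepNum` is the size of a largest independent set. Equivalently, the coefficient
sequence of the independence polynomial of `G` is log-concave. -/
def IndepSeqLogConcave {V : Type*} [Fintype V] (G : SimpleGraph V) : Prop :=
  LogConcaveSeq (fun t => (indepSetCount G t : ℝ)) G.indepNum

/-- The independent set sequence `(i_G(0), …, i_G(α(G)))` is unimodal. -/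
def IndepSeqUnimodal {V : Type*} [Fintype V] (G : SimpleGraph V) : Prop :=
  UnimodalSeq (fun t => (indepSetCount G t : ℝ)) G.indepNum

/-- The `n`-concatenation `G^n(v,w)`: `n` disjoint copies of `G` (the vertex `(i, x)` is the
vertex `x` of copy `i`), together with an edge from the vertex `w` of copy `i` to the vertex `v`
of copy `i + 1`, for each `i` with `i + 1 < n`. -/
def concatenation {V : Type*} (G : SimpleGraph V) (v w : V) (n : ℕ) :
    SimpleGraph (Fin n × V) where
  Adj x y :=
    (x.1 = y.1 ∧ G.Adj x.2 y.2) ∨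
    (x.1.val + 1 = y.1.val ∧ x.2 = w ∧ y.2 = v) ∨
    (y.1.val + 1 = x.1.val ∧ y.2 = w ∧ x.2 = v)
  symm := ⟨by
    rintro x y (⟨h, h'⟩ | h | h)
    · exact Or.inl ⟨h.symm, h'.symm⟩
    · exact Or.inr (Or.inr h)
    · exact Or.inr (Or.inl h)⟩
  loopless := ⟨by
    rintro x (⟨_, h⟩ | ⟨h, _⟩ | ⟨h, _⟩)
    · exact G.loopless.irrefl _ h
    · omega
    · omega⟩

/-- The double star: the centres `v = inl 0` and `w = inl 1` are adjacent, `v` has the `ℓ₁`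
further pendant neighbours `inr (inl i)`, and `w` has the `ℓ₂` further pendant neighbours
`inr (inr j)`. -/
def doubleStar (ℓ₁ ℓ₂ : ℕ) : SimpleGraph (Fin 2 ⊕ (Fin ℓ₁ ⊕ Fin ℓ₂)) :=
  SimpleGraph.fromRel fun x y =>
    match x, y with
    | .inl i, .inl j => i = 0 ∧ j = 1
    | .inl i, .inr (.inl _) => i = 0
    | .inl i, .inr (.inr _) => i = 1
    | .inr _, _ => False

/-- The caterpillar with `k i` pendant edges at the vertex `i` of a path on `m` vertices: the
spine is `inl 0, …, inl (m - 1)` and the pendant neighbours of `inl i` are the `inr ⟨i, j⟩`. -/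
def caterpillar (m : ℕ) (k : Fin m → ℕ) : SimpleGraph (Fin m ⊕ (Σ i : Fin m, Fin (k i))) :=
  SimpleGraph.fromRel fun x y =>
    match x, y with
    | .inl i, .inl j => i.val + 1 = j.val
    | .inl i, .inr p => i = p.1
    | .inr _, _ => False

/-- A path on `m` vertices with a path of length `d i` attached at one of its ends to the
vertex `i`: the spine is `⟨0, 0⟩, …, ⟨m - 1, 0⟩`, and the path attached at `⟨i, 0⟩` is
`⟨i, 0⟩, ⟨i, 1⟩, …, ⟨i, d i⟩`. -/
def pathWithPendantPaths (m : ℕ) (d : Fin m → ℕ) :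
    SimpleGraph (Σ i : Fin m, Fin (d i + 1)) :=
  SimpleGraph.fromRel fun x y =>
    (x.1 = y.1 ∧ x.2.val + 1 = y.2.val) ∨
    (x.1.val + 1 = y.1.val ∧ x.2.val = 0 ∧ y.2.val = 0)

/-!
The independent sets of a concatenation can be counted copy by copy. Let `p` be the independence
polynomial of `G`, and let `B` and `C` be the contributions to `p` of the independent sets
containing `v` and `w`. Since `v` and `w` are adjacent, the independence polynomials `S n` of the
concatenations satisfy `S (n + 2) = p * S (n + 1) - q * S n` with `q = B * C`
(`indepPoly_concatenation`). This is the recurrence of the Chebyshev polynomials of the second kind,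
whose roots are known, so `S n` is a product of the quadratic factors `p² - c q` with
`c = 4 cos² (j π / (n + 1))`, and of one more factor `p` if `n` is odd (`continuantSeq_eq_prod`).
Products of log-concave polynomials with positive coefficients are log-concave
(`LogConcave.mul`), so it is enough to show that `p² - c q` is log-concave for all `c ∈ [0, 4]`.
This is true except for the paths on three and five vertices (the first of which is also the double
star with a single pendant edge), where it fails for `c` close to `4`. In these cases the factor
with parameter `c` is multiplied by one with parameter `d ≤ 4 - c`, which the reflection
`j ↦ ⌊n/2⌋ + 1 - j` provides, and the product is log-concave (`ContinuantLogConcave`).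

For double stars with `a` and `a + d` pendant edges, put `w = (1 + x)^d` and `h = (1 + x)^a + x`.
Up to the factor `(1 + x)^(2a)`, the polynomial `p² - c q` is `w (h (w h + 2x) - c x²) + x²`. It is
built from log-concave polynomials by multiplication and by changes of a single coefficient, and
such a change affects only three of the inequalities (`LogConcave.update`). They are explicit
polynomial inequalities in `a`, `d` and `c`.

For paths, `p` and `q` are given by the Fibonacci polynomials `F n`, as `p = F (k + 2)` and
`q = x² F k F (k - 1)`, and a Cassini identity shows that
`p² - c q = F k (F (k + 4) - c x² F (k - 1)) + (-x)^k` (`fibPoly_factor`). The second factor has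
explicit coefficients, and its log-concavity is a polynomial inequality (`pathD_lc`); the monomial
only changes one of the two top coefficients of the product. The argument applies to paths of
any length; for a few short paths the factors are written out.

All polynomial inequalities are quadratic in `c`. They are checked on the Bernstein coefficients
with respect to the interval `[0, 4]` (`weighted_lc_of_bernstein`). After a shift of the remaining
variables these are polynomials with nonnegative coefficients, apart from single terms that are
absorbed by a square.
-/

open Polynomial

/-! ### Log-concave polynomials -/

/-- A real polynomial is *log-concave* if its coefficients are nonnegative, satisfy
`p_i p_{i+2} ≤ p_{i+1}²`, and form an initial segment of nonzero entries followed by zeros. -/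
structure LogConcave (p : ℝ[X]) : Prop where
  nonneg : ∀ i, 0 ≤ p.coeff i
  zero : ∀ i, p.coeff i = 0 → p.coeff (i + 1) = 0
  lc : ∀ i, p.coeff i * p.coeff (i + 2) ≤ p.coeff (i + 1) ^ 2

namespace LogConcave

theorem zero_of_le {p : ℝ[X]} (hp : LogConcave p) {i j : ℕ} (hij : i ≤ j)
    (h : p.coeff i = 0) : p.coeff j = 0 := by
  induction j, hij using Nat.le_induction with
  | base => exact h
  | succ j _ ih => exact hp.zero j ih

/-- Local log-concavity propagates: the ratios `p_{i+1} / p_i` are nonincreasing. -/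
theorem ratio {p : ℝ[X]} (hp : LogConcave p) {i j : ℕ} (hij : i ≤ j) :
    p.coeff i * p.coeff (j + 1) ≤ p.coeff (i + 1) * p.coeff j := by
  induction j, hij using Nat.le_induction with
  | base => exact le_of_eq (mul_comm _ _)
  | succ j hij ih =>
    rcases (hp.nonneg j).eq_or_lt with h | h
    · have h2 : p.coeff (j + 1 + 1) = 0 := hp.zero_of_le (by omega) h.symm
      rw [h2, mul_zero]
      exact mul_nonneg (hp.nonneg _) (hp.nonneg _)
    · rcases (hp.nonneg (j + 1)).eq_or_lt with h1 | h1
      · rw [hp.zero _ h1.symm, mul_zero]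
        exact mul_nonneg (hp.nonneg _) (hp.nonneg _)
      · have h3 := hp.lc j
        have h4 := hp.nonneg i
        have h5 := hp.nonneg (j + 1 + 1)
        refine le_of_mul_le_mul_left ?_ h
        calc p.coeff j * (p.coeff i * p.coeff (j + 1 + 1))
            = p.coeff i * (p.coeff j * p.coeff (j + 2)) := by ring
          _ ≤ p.coeff i * p.coeff (j + 1) ^ 2 := by gcongr
          _ = (p.coeff i * p.coeff (j + 1)) * p.coeff (j + 1) := by ring
          _ ≤ (p.coeff (i + 1) * p.coeff j) * p.coeff (j + 1) := by gcongr
          _ = p.coeff j * (p.coeff (i + 1) * p.coeff (j + 1)) := by ring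

/-- The `2 × 2` minors of the two-row matrix formed by `p_i` and `p_{i-1}` have a sign. -/
theorem ratio_shift {p : ℝ[X]} (hp : LogConcave p) {i j : ℕ} (hij : i ≤ j) :
    (X * p).coeff i * p.coeff j ≤ p.coeff i * (X * p).coeff j := by
  rcases i with _ | i
  · simp only [mul_coeff_zero, coeff_X_zero, zero_mul]
    rcases j with _ | j
    · simp
    · rw [coeff_X_mul]; exact mul_nonneg (hp.nonneg _) (hp.nonneg _)
  · obtain ⟨j, rfl⟩ : ∃ k, j = k + 1 := ⟨j - 1, by omega⟩
    rw [coeff_X_mul, coeff_X_mul]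
    exact hp.ratio (by omega)

open Finset.HasAntidiagonal in
/-- The product of log-concave polynomials is log-concave. The defect
`r_{n+1}² - r_n r_{n+2}` of the product is, by the Cauchy–Binet formula, a sum of products of
`2 × 2` minors of the factors. -/
theorem mul {p q : ℝ[X]} (hp : LogConcave p) (hq : LogConcave q) : LogConcave (p * q) := by
  refine ⟨fun i => ?_, fun i hi => ?_, fun n => ?_⟩
  · rw [coeff_mul]
    exact Finset.sum_nonneg fun x _ => mul_nonneg (hp.nonneg _) (hq.nonneg _)
  · rw [coeff_mul] at hi ⊢
    rw [Finset.sum_eq_zero_iff_of_nonneg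
      (fun x _ => mul_nonneg (hp.nonneg _) (hq.nonneg _))] at hi
    refine Finset.sum_eq_zero fun x hx => ?_
    obtain ⟨a, b⟩ := x
    rw [mem_antidiagonal] at hx
    simp only at hx ⊢
    rcases a with _ | a
    · obtain ⟨b, rfl⟩ : ∃ k, b = k + 1 := ⟨b - 1, by omega⟩
      rcases mul_eq_zero.1 (hi (0, b) (by rw [mem_antidiagonal]; omega)) with h | h
      · simp only at h; simp [h]
      · simp [hq.zero _ h]
    · rcases mul_eq_zero.1 (hi (a, b) (by rw [mem_antidiagonal]; omega)) with h | h
      · simp [hp.zero _ h]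
      · simp only at h; simp [h]
  · have key : 0 ≤ ∑ x ∈ antidiagonal (n + 2), ∑ y ∈ antidiagonal (n + 2),
        (p.coeff x.1 * (X * p).coeff y.1 - p.coeff y.1 * (X * p).coeff x.1) *
        ((X * q).coeff x.2 * q.coeff y.2 - q.coeff x.2 * (X * q).coeff y.2) := by
      refine Finset.sum_nonneg fun x hx => Finset.sum_nonneg fun y hy => ?_
      rw [mem_antidiagonal] at hx hy
      rcases le_total x.1 y.1 with h | h
      · have h1 := hp.ratio_shift h
        have h2 := hq.ratio_shift (i := y.2) (j := x.2) (by omega)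
        exact mul_nonneg (by linarith) (by linarith)
      · have h1 := hp.ratio_shift h
        have h2 := hq.ratio_shift (i := x.2) (j := y.2) (by omega)
        exact mul_nonneg_of_nonpos_of_nonpos (by linarith) (by linarith)
    have e0 : ∑ x ∈ antidiagonal (n + 2), p.coeff x.1 * q.coeff x.2
        = (p * q).coeff (n + 2) := (coeff_mul _ _ _).symm
    have e1 : ∑ x ∈ antidiagonal (n + 2), (X * p).coeff x.1 * q.coeff x.2
        = (p * q).coeff (n + 1) := by
      rw [← coeff_mul, mul_assoc, coeff_X_mul]
    have e2 : ∑ x ∈ antidiagonal (n + 2), p.coeff x.1 * (X * q).coeff x.2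
        = (p * q).coeff (n + 1) := by
      rw [← coeff_mul, mul_left_comm, coeff_X_mul]
    have e3 : ∑ x ∈ antidiagonal (n + 2), (X * p).coeff x.1 * (X * q).coeff x.2
        = (p * q).coeff n := by
      rw [← coeff_mul, mul_assoc, coeff_X_mul, mul_left_comm, coeff_X_mul]
    have : ∑ x ∈ antidiagonal (n + 2), ∑ y ∈ antidiagonal (n + 2),
        (p.coeff x.1 * (X * p).coeff y.1 - p.coeff y.1 * (X * p).coeff x.1) *
        ((X * q).coeff x.2 * q.coeff y.2 - q.coeff x.2 * (X * q).coeff y.2)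
        = 2 * ((p * q).coeff (n + 1) ^ 2 - (p * q).coeff n * (p * q).coeff (n + 2)) := by
      have expand : ∀ x y : ℕ × ℕ,
          (p.coeff x.1 * (X * p).coeff y.1 - p.coeff y.1 * (X * p).coeff x.1) *
          ((X * q).coeff x.2 * q.coeff y.2 - q.coeff x.2 * (X * q).coeff y.2)
          = (p.coeff x.1 * (X * q).coeff x.2) * ((X * p).coeff y.1 * q.coeff y.2)
            - (p.coeff x.1 * q.coeff x.2) * ((X * p).coeff y.1 * (X * q).coeff y.2)
            - ((X * p).coeff x.1 * (X * q).coeff x.2) * (p.coeff y.1 * q.coeff y.2)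
            + ((X * p).coeff x.1 * q.coeff x.2) * (p.coeff y.1 * (X * q).coeff y.2) := by
        intro x y; ring
      simp only [expand, Finset.sum_add_distrib, Finset.sum_sub_distrib, ← Finset.mul_sum,
        ← Finset.sum_mul, e0, e1, e2, e3]
      ring
    linarith

theorem one : LogConcave (1 : ℝ[X]) := by
  refine ⟨fun i => ?_, fun i _ => ?_, fun i => ?_⟩
  · rw [coeff_one]; split_ifs <;> norm_num
  · rw [coeff_one, if_neg (by omega)]
  · rw [coeff_one (n := i + 2), if_neg (by omega), mul_zero]; positivity

theorem pow {p : ℝ[X]} (hp : LogConcave p) (n : ℕ) : LogConcave (p ^ n) := by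
  induction n with
  | zero => simpa using one
  | succ n ih => rw [pow_succ]; exact ih.mul hp

theorem prod {ι : Type*} (s : Finset ι) (f : ι → ℝ[X]) (h : ∀ i ∈ s, LogConcave (f i)) :
    LogConcave (∏ i ∈ s, f i) :=
  Finset.prod_induction f LogConcave (fun _ _ => mul) one h

/-- A criterion in which the positive coefficients are those below `N`. -/
theorem of_pos {p : ℝ[X]} (N : ℕ) (hpos : ∀ i < N, 0 < p.coeff i) (hN : 0 ≤ p.coeff N)
    (hz : ∀ i, N < i → p.coeff i = 0)
    (hlc : ∀ i, i + 2 ≤ N → p.coeff i * p.coeff (i + 2) ≤ p.coeff (i + 1) ^ 2) :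
    LogConcave p := by
  refine ⟨fun i => ?_, fun i hi => ?_, fun i => ?_⟩
  · rcases lt_trichotomy i N with h | rfl | h
    · exact (hpos i h).le
    · exact hN
    · exact (hz i h).ge
  · by_cases h : i < N
    · exact absurd hi (hpos i h).ne'
    · exact hz _ (by omega)
  · by_cases h : i + 2 ≤ N
    · exact hlc i h
    · rw [hz (i + 2) (by omega), mul_zero]; positivity

/-- Changing the single coefficient of index `m` only affects three of the inequalities. -/
theorem update {p r : ℝ[X]} (hp : LogConcave p) (m : ℕ) (h : ∀ i, i ≠ m → r.coeff i = p.coeff i)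
    (hm : 0 < r.coeff m) (hprev : ∀ i, i < m → p.coeff i ≠ 0)
    (hlc : ∀ i, i ≤ m → m ≤ i + 2 → r.coeff i * r.coeff (i + 2) ≤ r.coeff (i + 1) ^ 2) :
    LogConcave r := by
  refine ⟨fun i => ?_, fun i hi => ?_, fun i => ?_⟩
  · rcases eq_or_ne i m with rfl | hne
    · exact hm.le
    · rw [h i hne]; exact hp.nonneg i
  · have hne : i ≠ m := by rintro rfl; exact hm.ne' hi
    rw [h i hne] at hi
    have hlt : m < i := by
      by_contra hc
      exact hprev i (by omega) hi
    rw [h _ (by omega)]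
    exact hp.zero i hi
  · by_cases hc : i ≤ m ∧ m ≤ i + 2
    · exact hlc i hc.1 hc.2
    · rw [h i (by omega), h (i + 1) (by omega), h (i + 2) (by omega)]
      exact hp.lc i

end LogConcave

/-- The polynomial with a given list of coefficients, constant term first. -/
noncomputable def polyOfList : List ℝ → ℝ[X]
  | [] => 0
  | a :: l => C a + X * polyOfList l

theorem coeff_polyOfList (l : List ℝ) (i : ℕ) : (polyOfList l).coeff i = l.getD i 0 := by
  induction l generalizing i with
  | nil => simp [polyOfList]
  | cons a l ih =>
    rcases i with _ | i
    · simp [polyOfList]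
    · simp [polyOfList, coeff_X_mul, coeff_C_succ, ih]

/-- The log-concavity inequalities for consecutive entries of a list, with positivity of the
entries other than the last, which is only required to be nonnegative. -/
def ListLC : List ℝ → Prop
  | [] => True
  | [a] => 0 ≤ a
  | [a, b] => 0 < a ∧ 0 ≤ b
  | a :: b :: c :: l => 0 < a ∧ a * c ≤ b ^ 2 ∧ ListLC (b :: c :: l)

theorem LogConcave.of_list : ∀ l : List ℝ, ListLC l → LogConcave (polyOfList l)
  | [], _ => ⟨by simp [coeff_polyOfList], by simp [coeff_polyOfList], by simp [coeff_polyOfList]⟩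
  | [a], h => by
    refine LogConcave.of_pos 0 (by simp)
          (by simpa [coeff_polyOfList, ListLC] using h) (fun i hi => ?_)
      (by simp)
    rw [coeff_polyOfList, List.getD_eq_default _ _
          (by simp only [List.length_cons, List.length_nil]; omega)]
  | [a, b], h => by
    refine LogConcave.of_pos 1 (fun i hi => ?_) (by simpa [coeff_polyOfList] using h.2)
      (fun i hi => ?_) (by simp)
    · obtain rfl : i = 0 := by omega
      simpa [coeff_polyOfList] using h.1
    · rw [coeff_polyOfList, List.getD_eq_default _ _
          (by simp only [List.length_cons, List.length_nil]; omega)]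
  | a :: b :: c :: l, h => by
    have ih := LogConcave.of_list (b :: c :: l) h.2.2
    have e : ∀ i, (polyOfList (a :: b :: c :: l)).coeff (i + 1)
        = (polyOfList (b :: c :: l)).coeff i := by
      intro i; simp [coeff_polyOfList]
    have e0 : (polyOfList (a :: b :: c :: l)).coeff 0 = a := by simp [coeff_polyOfList]
    refine ⟨fun i => ?_, fun i hi => ?_, fun i => ?_⟩
    · rcases i with _ | i
      · rw [e0]; exact h.1.le
      · rw [e]; exact ih.nonneg i
    · rcases i with _ | i
      · rw [e0] at hi; exact absurd hi h.1.ne'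
      · rw [e] at hi ⊢; exact ih.zero i hi
    · rcases i with _ | i
      · simpa [coeff_polyOfList] using h.2.1
      · rw [e, e, e]; exact ih.lc i

/-! ### Chebyshev factorization of a second-order recurrence -/

/-- The sequence with `S 0 = 1`, `S 1 = p` and `S (n + 2) = p * S (n + 1) - q * S n`. -/
def continuantSeq {R : Type*} [CommRing R] (p q : R) : ℕ → R
  | 0 => 1
  | 1 => p
  | n + 2 => p * continuantSeq p q (n + 1) - q * continuantSeq p q n

theorem map_continuantSeq {R S : Type*} [CommRing R] [CommRing S] (φ : R →+* S) (p q : R)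
    (n : ℕ) : φ (continuantSeq p q n) = continuantSeq (φ p) (φ q) n := by
  induction n using Nat.twoStepInduction with
  | zero => simp [continuantSeq]
  | one => simp [continuantSeq]
  | more n h0 h1 => simp [continuantSeq, h0, h1]

/-- A product over `range n` with the factors of index `k` and `n - 1 - k` paired. -/
theorem Finset.prod_range_eq_prod_fold {M : Type*} [CommMonoid M] (f : ℕ → M) (n : ℕ) :
    ∏ k ∈ Finset.range n, f k =
      (∏ k ∈ Finset.range (n / 2), f k * f (n - 1 - k)) * if n % 2 = 1 then f (n / 2) else 1 := by
  induction n using Nat.twoStepInduction generalizing f with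
  | zero => simp
  | one => simp
  | more n h0 _ =>
    rw [Finset.prod_range_succ, Finset.prod_range_succ', h0,
      show (n + 2) / 2 = n / 2 + 1 by omega, Finset.prod_range_succ',
      show (n + 2) % 2 = n % 2 by omega]
    have : ∀ k ∈ Finset.range (n / 2), f (k + 1) * f (n - 1 - k + 1)
        = f (k + 1) * f (n + 2 - 1 - (k + 1)) := by
      intro k hk
      rw [Finset.mem_range] at hk
      rw [show n - 1 - k + 1 = n + 2 - 1 - (k + 1) by omega]
    rw [Finset.prod_congr rfl this]
    simp only [show n + 2 - 1 - 0 = n + 1 by omega]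
    ac_rfl

open Real in
theorem continuantSeq_eq_chebyshev (a : ℝ) {y : ℝ} (hy : y ≠ 0) (n : ℕ) :
    continuantSeq a (y ^ 2) n = y ^ n * (Chebyshev.U ℝ n).eval (a / (2 * y)) := by
  induction n using Nat.twoStepInduction with
  | zero => simp [continuantSeq]
  | one => simp [continuantSeq]; field_simp
  | more n h0 h1 =>
    rw [continuantSeq, h0, h1]
    push_cast
    rw [Chebyshev.U_add_two]
    simp only [eval_sub, eval_mul, eval_X, eval_ofNat]
    field_simp
    ring

open Real in
theorem chebyshev_U_eval_eq_prod (n : ℕ) (x : ℝ) :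
    (Chebyshev.U ℝ n).eval x =
      2 ^ n * ∏ k ∈ Finset.range n, (x - cos ((k + 1) * π / (n + 1))) := by
  have hinj := (Finset.range n).nodup_map_iff_injOn.mp (Chebyshev.roots_U_real_nodup n)
  have hroots := Chebyshev.roots_U_real n
  have hcard : Multiset.card (Chebyshev.U ℝ n).roots = (Chebyshev.U ℝ n).natDegree := by
    rw [hroots, Finset.card_val, Finset.card_image_of_injOn hinj, Finset.card_range,
      Chebyshev.natDegree_U_natCast]
  have h := C_leadingCoeff_mul_prod_multiset_X_sub_C hcard
  rw [hroots] at h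
  rw [← h, eval_mul, eval_C, Chebyshev.leadingCoeff_U_natCast]
  congr 1
  change eval x (∏ a ∈ Finset.image _ _, (X - C a)) = _
  rw [Finset.prod_image hinj, eval_prod]
  simp

open Real in
theorem continuantSeq_real (a : ℝ) {y : ℝ} (hy : y ≠ 0) (n : ℕ) :
    continuantSeq a (y ^ 2) n =
      ∏ k ∈ Finset.range n, (a - 2 * y * cos ((k + 1) * π / (n + 1))) := by
  rw [continuantSeq_eq_chebyshev a hy, chebyshev_U_eval_eq_prod, ← mul_assoc, ← mul_pow,
    show (y * 2) ^ n = ∏ _k ∈ Finset.range n, (y * 2) by simp, ← Finset.prod_mul_distrib]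
  refine Finset.prod_congr rfl fun k _ => ?_
  field_simp

/-- The numbers `4 cos² ((j + 1) π / (n + 1))`, the squares of the roots of the rescaled Chebyshev
polynomial of the second kind of degree `n`. -/
noncomputable def chebyshevNode (n j : ℕ) : ℝ :=
  4 * Real.cos ((j + 1) * Real.pi / (n + 1)) ^ 2

theorem chebyshevNode_nonneg (n j : ℕ) : 0 ≤ chebyshevNode n j := by
  unfold chebyshevNode; positivity

open Real in
/-- Reflecting the index within the first half of the nodes sends a node close to `4` to a node
close to `0`. -/
theorem chebyshevNode_add_le {n j : ℕ} (hj : j < n / 2) :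
    chebyshevNode n j + chebyshevNode n (n / 2 - 1 - j) ≤ 4 := by
  have hπ := pi_pos
  have hn : (0 : ℝ) < n + 1 := by positivity
  set m := n / 2 with hm
  have hmn : (n : ℝ) + 1 ≤ 2 * (m + 1) := by norm_cast; omega
  have hmn' : 2 * (m : ℝ) ≤ n := by norm_cast; omega
  have hcast : ((m - 1 - j : ℕ) : ℝ) = m - 1 - j := by
    rw [show m - 1 - j = m - (j + 1) by omega, Nat.cast_sub (by omega)]
    push_cast; ring
  have hjm : (j : ℝ) + 1 ≤ m := by exact_mod_cast hj
  unfold chebyshevNode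
  rw [hcast]
  set θ := ((j : ℝ) + 1) * π / (n + 1) with hθ
  set φ := ((m : ℝ) - 1 - j + 1) * π / (n + 1) with hφ
  have h1 : 0 ≤ π / 2 - θ := by
    rw [hθ, sub_nonneg, div_le_div_iff₀ hn two_pos]
    nlinarith
  have h2 : φ ≤ π := by
    rw [hφ, div_le_iff₀ hn]
    nlinarith
  have h3 : π / 2 - θ ≤ φ := by
    have : π / 2 ≤ θ + φ := by
      rw [hθ, hφ, ← add_div, div_le_div_iff₀ two_pos hn]
      nlinarith
    linarith
  have h4 : 0 ≤ cos φ := by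
    refine cos_nonneg_of_neg_pi_div_two_le_of_le (by linarith) ?_
    rw [hφ, div_le_div_iff₀ hn two_pos]
    have : 0 ≤ (j : ℝ) := by positivity
    nlinarith
  have h5 : cos φ ≤ sin θ := by
    rw [← cos_pi_div_two_sub]
    exact cos_le_cos_of_nonneg_of_le_pi h1 h2 h3
  nlinarith [sin_sq_add_cos_sq θ]

open Real in
/-- The linear factors with opposite cosines are combined into quadratic ones. -/
theorem continuantSeq_real_eq_prod_sq (a : ℝ) {b : ℝ} (hb : 0 < b) (n : ℕ) :
    continuantSeq a b n = (∏ j ∈ Finset.range (n / 2), (a ^ 2 - chebyshevNode n j * b)) *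
      if n % 2 = 1 then a else 1 := by
  have hy : 0 < √b := sqrt_pos.2 hb
  have hyb : √b ^ 2 = b := sq_sqrt hb.le
  conv_lhs => rw [← hyb]
  rw [continuantSeq_real a hy.ne', Finset.prod_range_eq_prod_fold]
  have hn : (0 : ℝ) < n + 1 := by positivity
  congr 1
  · refine Finset.prod_congr rfl fun k hk => ?_
    rw [Finset.mem_range] at hk
    have hcast : ((n - 1 - k : ℕ) : ℝ) = n - 1 - k := by
      rw [show n - 1 - k = n - (k + 1) by omega, Nat.cast_sub (by omega)]
      push_cast; ring
    have : ((n - 1 - k : ℕ) + 1 : ℝ) * π / (n + 1) = π - (k + 1) * π / (n + 1) := by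
      rw [hcast]; field_simp; ring
    rw [this, cos_pi_sub, chebyshevNode, ← hyb, sqrt_sq hy.le]
    ring
  · split_ifs with h
    · have h2 : (((n / 2 : ℕ) : ℝ) + 1) * π / (n + 1) = π / 2 := by
        have : (n : ℝ) = 2 * (n / 2 : ℕ) + 1 := by norm_cast; omega
        rw [div_eq_div_iff hn.ne' two_ne_zero]
        conv_rhs => rw [this]
        ring
      rw [h2, cos_pi_div_two]; ring
    · rfl

/-- The factorization of `continuantSeq p q n` into quadratic factors. -/
theorem continuantSeq_eq_prod (p q : ℝ[X]) (hq : ∀ x : ℝ, 0 < x → 0 < q.eval x) (n : ℕ) :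
    continuantSeq p q n = (∏ j ∈ Finset.range (n / 2), (p ^ 2 - C (chebyshevNode n j) * q)) *
      if n % 2 = 1 then p else 1 := by
  refine Polynomial.eq_of_infinite_eval_eq _ _ ((Set.Ioi_infinite (0 : ℝ)).mono fun x hx => ?_)
  have h1 := map_continuantSeq (evalRingHom x) p q n
  rw [coe_evalRingHom] at h1
  rw [Set.mem_ofPred_eq, h1, continuantSeq_real_eq_prod_sq _ (hq x hx), eval_mul, eval_prod]
  congr 1
  · simp
  · split_ifs <;> simp

/-- The hypothesis under which all `continuantSeq p q n` are log-concave. Of the factors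
`p² - c q` with `0 ≤ c ≤ 4`, only those with `c ≤ 2` have to be log-concave by themselves; the
others are multiplied by a factor with a smaller `c` first. -/
structure ContinuantLogConcave (p q : ℝ[X]) : Prop where
  base : LogConcave p
  single : ∀ c : ℝ, 0 ≤ c → c ≤ 2 → LogConcave (p ^ 2 - C c * q)
  pair : ∀ c d : ℝ, 0 ≤ c → 0 ≤ d → c + d ≤ 4 →
    LogConcave ((p ^ 2 - C c * q) * (p ^ 2 - C d * q))

theorem ContinuantLogConcave.of_single {p q : ℝ[X]} (hp : LogConcave p)
    (h : ∀ c : ℝ, 0 ≤ c → c ≤ 4 → LogConcave (p ^ 2 - C c * q)) : ContinuantLogConcave p q where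
  base := hp
  single c h0 h2 := h c h0 (by linarith)
  pair c d hc hd hcd := (h c hc (by linarith)).mul (h d hd (by linarith))

theorem ContinuantLogConcave.logConcave {p q : ℝ[X]} (h : ContinuantLogConcave p q)
    (hq : ∀ x : ℝ, 0 < x → 0 < q.eval x) (n : ℕ) : LogConcave (continuantSeq p q n) := by
  rw [continuantSeq_eq_prod p q hq]
  refine LogConcave.mul ?_ ?_
  · rw [Finset.prod_range_eq_prod_fold]
    refine LogConcave.mul (LogConcave.prod _ _ fun j hj => ?_) ?_
    · rw [Finset.mem_range] at hj
      exact h.pair _ _ (chebyshevNode_nonneg _ _) (chebyshevNode_nonneg _ _)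
        (chebyshevNode_add_le (by omega))
    · split_ifs with hodd
      · -- the middle node is its own reflection
        have h4 := chebyshevNode_add_le (n := n) (j := n / 2 / 2) (by omega)
        rw [show n / 2 - 1 - n / 2 / 2 = n / 2 / 2 by omega] at h4
        exact h.single _ (chebyshevNode_nonneg _ _) (by linarith)
      · exact LogConcave.one
  · split_ifs
    · exact h.base
    · exact LogConcave.one

/-! ### Verification of coefficient inequalities -/

theorem cast_choose_three (n : ℕ) : (n.choose 3 : ℝ) = n * (n - 1) * (n - 2) / 6 := by
  induction n with
  | zero => simp
  | succ n ih =>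
    rw [Nat.choose_succ_succ, Nat.cast_add, ih, Nat.cast_choose_two]; push_cast; ring

theorem cast_choose_four (n : ℕ) : (n.choose 4 : ℝ) = n * (n - 1) * (n - 2) * (n - 3) / 24 := by
  induction n with
  | zero => simp
  | succ n ih =>
    rw [Nat.choose_succ_succ, Nat.cast_add, ih, cast_choose_three]; push_cast; ring

theorem logConcave_one_add_X_pow (n : ℕ) : LogConcave ((1 + X : ℝ[X]) ^ n) := by
  refine LogConcave.pow ?_ n
  have h : polyOfList [1, 1] = 1 + X := by simp [polyOfList]
  rw [← h]
  exact LogConcave.of_list _ (by norm_num [ListLC])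

/-- A quadratic inequality in `c` on `[0, 4]`, verified on its Bernstein coefficients. -/
theorem weighted_lc_of_bernstein {v w s t s₁ t₁ s₃ t₃ c : ℝ} (hc : 0 ≤ c) (hc4 : c ≤ 4)
    (h0 : 0 ≤ v * s ^ 2 - w * (s₁ * s₃))
    (h1 : 0 ≤ v * (2 * s * (s - 4 * t)) - w * (s₁ * (s₃ - 4 * t₃) + (s₁ - 4 * t₁) * s₃))
    (h2 : 0 ≤ v * (s - 4 * t) ^ 2 - w * ((s₁ - 4 * t₁) * (s₃ - 4 * t₃))) :
    w * ((s₁ - c * t₁) * (s₃ - c * t₃)) ≤ v * (s - c * t) ^ 2 := by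
  have e0 : 0 ≤ 4 - c := by linarith
  have a0 := mul_nonneg (mul_nonneg e0 e0) h0
  have a1 := mul_nonneg (mul_nonneg e0 hc) h1
  have a2 := mul_nonneg (mul_nonneg hc hc) h2
  have : 16 * (v * (s - c * t) ^ 2 - w * ((s₁ - c * t₁) * (s₃ - c * t₃))) =
    (4 - c) * (4 - c) * (v * s ^ 2 - w * (s₁ * s₃)) +
    (4 - c) * c * (v * (2 * s * (s - 4 * t)) -
      w * (s₁ * (s₃ - 4 * t₃) + (s₁ - 4 * t₁) * s₃)) +
    c * c * (v * (s - 4 * t) ^ 2 - w * ((s₁ - 4 * t₁) * (s₃ - 4 * t₃))) := by ring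
  linarith

theorem lc_of_bernstein {s t s₁ t₁ s₃ t₃ c : ℝ} (hc : 0 ≤ c) (hc4 : c ≤ 4)
    (h0 : 0 ≤ s ^ 2 - s₁ * s₃)
    (h1 : 0 ≤ 2 * s * (s - 4 * t) - (s₁ * (s₃ - 4 * t₃) + (s₁ - 4 * t₁) * s₃))
    (h2 : 0 ≤ (s - 4 * t) ^ 2 - (s₁ - 4 * t₁) * (s₃ - 4 * t₃)) :
    (s₁ - c * t₁) * (s₃ - c * t₃) ≤ (s - c * t) ^ 2 := by
  have := weighted_lc_of_bernstein (v := 1) (w := 1) hc hc4 (by simpa using h0)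
    (by simpa using h1) (by simpa using h2)
  simpa using this

theorem nonneg_of_nonneg_sub {x y : ℝ} (hy : 0 ≤ y) (h : 0 ≤ x - y) : 0 ≤ x := by linarith

section coeff
variable (p q : ℝ[X])

theorem coeff_mul_one : (p * q).coeff 1 = p.coeff 0 * q.coeff 1 + p.coeff 1 * q.coeff 0 := by
  simp [coeff_mul, Finset.Nat.antidiagonal_succ]

theorem coeff_mul_two : (p * q).coeff 2 =
    p.coeff 0 * q.coeff 2 + p.coeff 1 * q.coeff 1 + p.coeff 2 * q.coeff 0 := by
  simp [coeff_mul, Finset.Nat.antidiagonal_succ]; ring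

theorem coeff_mul_three : (p * q).coeff 3 = p.coeff 0 * q.coeff 3 + p.coeff 1 * q.coeff 2 +
    p.coeff 2 * q.coeff 1 + p.coeff 3 * q.coeff 0 := by
  simp [coeff_mul, Finset.Nat.antidiagonal_succ]; ring

theorem coeff_mul_four : (p * q).coeff 4 = p.coeff 0 * q.coeff 4 + p.coeff 1 * q.coeff 3 +
    p.coeff 2 * q.coeff 2 + p.coeff 3 * q.coeff 1 + p.coeff 4 * q.coeff 0 := by
  simp [coeff_mul, Finset.Nat.antidiagonal_succ]; ring

end coeff

/-! ### Quadratic factors of small trees -/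

theorem logConcave_path_two_factor {c : ℝ} (hc : 0 ≤ c) (hc4 : c ≤ 4) :
    LogConcave ((1 + 2 * X : ℝ[X]) ^ 2 - C c * (X ^ 2)) := by
  have h : (1 + 2 * X : ℝ[X]) ^ 2 - C c * (X ^ 2) = polyOfList [
    1 - c * 0, 4 - c * 0, 4 - c * 1] := by
    simp only [polyOfList, map_sub, map_mul, map_ofNat, map_one, map_zero]
    ring
  rw [h]
  refine LogConcave.of_list _ ?_
  simp only [ListLC]
  refine ⟨?_, ?_, ?_, ?_⟩ <;>
  first
  | (refine lc_of_bernstein hc hc4 ?_ ?_ ?_ <;> norm_num)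
  | linarith

theorem logConcave_path_three_factor {c : ℝ} (hc : 0 ≤ c) (hc4 : c ≤ 2) :
    LogConcave ((1 + 3 * X + X ^ 2 : ℝ[X]) ^ 2 - C c * (X ^ 2 + X ^ 3)) := by
  have h : (1 + 3 * X + X ^ 2 : ℝ[X]) ^ 2 - C c * (X ^ 2 + X ^ 3) = polyOfList [
    1 - c * 0, 6 - c * 0, 11 - c * 1, 6 - c * 1, 1 - c * 0] := by
    simp only [polyOfList, map_sub, map_mul, map_ofNat, map_one, map_zero]
    ring
  rw [h]
  refine LogConcave.of_list _ ?_
  simp only [ListLC]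
  refine ⟨?_, ?_, ?_, ?_, ?_, ?_, ?_, ?_⟩ <;>
  first
  | (refine lc_of_bernstein hc (hc4.trans (by norm_num)) ?_ ?_ ?_ <;> norm_num; done)
  | nlinarith

theorem logConcave_path_three_factor_mul {c d : ℝ} (hc : 0 ≤ c) (hd : 0 ≤ d) (hcd : c + d ≤ 4) :
    LogConcave (((1 + 3 * X + X ^ 2 : ℝ[X]) ^ 2 - C c * (X ^ 2 + X ^ 3)) *
      ((1 + 3 * X + X ^ 2) ^ 2 - C d * (X ^ 2 + X ^ 3))) := by
  -- the coefficients are made homogeneous in `c`, `d`, `4 - c - d`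
  obtain ⟨e, he⟩ : ∃ e, e = 4 - c - d := ⟨_, rfl⟩
  have he0 : 0 ≤ e := by linarith
  obtain ⟨T, hT⟩ : ∃ T, T = (c + d + e) / 4 := ⟨_, rfl⟩
  have hT1 : T = 1 := by rw [hT, he]; ring
  have hcd0 := mul_nonneg hc hd
  have h : ((1 + 3 * X + X ^ 2 : ℝ[X]) ^ 2 - C c * (X ^ 2 + X ^ 3)) *
      ((1 + 3 * X + X ^ 2) ^ 2 - C d * (X ^ 2 + X ^ 3)) = polyOfList [
    1 * T ^ 2, 12 * T ^ 2, 58 * T ^ 2 - 1 * (T * (c + d)), 144 * T ^ 2 - 7 * (T * (c + d)),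
    195 * T ^ 2 - 17 * (T * (c + d)) + 1 * (c * d),
    144 * T ^ 2 - 17 * (T * (c + d)) + 2 * (c * d),
    58 * T ^ 2 - 7 * (T * (c + d)) + 1 * (c * d), 12 * T ^ 2 - 1 * (T * (c + d)), 1 * T ^ 2] := by
    rw [hT1]
    simp only [polyOfList, map_sub, map_add, map_mul, map_ofNat, map_one, map_pow]
    ring
  rw [h]
  refine LogConcave.of_list _ ?_
  simp only [ListLC]
  refine ⟨?_, ?_, ?_, ?_, ?_, ?_, ?_, ?_, ?_, ?_, ?_, ?_, ?_, ?_, ?_, ?_⟩ <;>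
  first
  | (rw [hT1]; linarith)
  | (rw [hT, ← sub_nonneg]; ring_nf; positivity)

theorem logConcave_path_four_factor {c : ℝ} (hc : 0 ≤ c) (hc4 : c ≤ 4) :
    LogConcave ((1 + 4 * X + 3 * X ^ 2 : ℝ[X]) ^ 2 - C c * (X ^ 2 + 3 * X ^ 3 + 2 * X ^ 4)) := by
  have h : (1 + 4 * X + 3 * X ^ 2 : ℝ[X]) ^ 2 - C c * (X ^ 2 + 3 * X ^ 3 + 2 * X ^ 4) = polyOfList [
    1 - c * 0, 8 - c * 0, 22 - c * 1, 24 - c * 3, 9 - c * 2] := by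
    simp only [polyOfList, map_sub, map_mul, map_ofNat, map_one, map_zero]
    ring
  rw [h]
  refine LogConcave.of_list _ ?_
  simp only [ListLC]
  refine ⟨?_, ?_, ?_, ?_, ?_, ?_, ?_, ?_⟩ <;>
  first
  | (refine lc_of_bernstein hc hc4 ?_ ?_ ?_ <;> norm_num)
  | linarith

theorem logConcave_path_five_factor {c : ℝ} (hc : 0 ≤ c) (hc4 : c ≤ 2) :
    LogConcave ((1 + 5 * X + 6 * X ^ 2 + X ^ 3 : ℝ[X]) ^ 2 -
          C c * (X ^ 2 + 5 * X ^ 3 + 7 * X ^ 4 + 2 * X ^ 5)) := by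
  have h : (1 + 5 * X + 6 * X ^ 2 + X ^ 3 : ℝ[X]) ^ 2 -
        C c * (X ^ 2 + 5 * X ^ 3 + 7 * X ^ 4 + 2 * X ^ 5) = polyOfList [
    1 - c * 0, 10 - c * 0, 37 - c * 1, 62 - c * 5, 46 - c * 7, 12 - c * 2, 1 - c * 0] := by
    simp only [polyOfList, map_sub, map_mul, map_ofNat, map_one, map_zero]
    ring
  rw [h]
  refine LogConcave.of_list _ ?_
  simp only [ListLC]
  refine ⟨?_, ?_, ?_, ?_, ?_, ?_, ?_, ?_, ?_, ?_, ?_, ?_⟩ <;>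
  first
  | (refine lc_of_bernstein hc (hc4.trans (by norm_num)) ?_ ?_ ?_ <;> norm_num; done)
  | nlinarith

theorem logConcave_path_five_factor_mul {c d : ℝ} (hc : 0 ≤ c) (hd : 0 ≤ d) (hcd : c + d ≤ 4) :
    LogConcave (((1 + 5 * X + 6 * X ^ 2 + X ^ 3 : ℝ[X]) ^ 2 -
          C c * (X ^ 2 + 5 * X ^ 3 + 7 * X ^ 4 + 2 * X ^ 5)) *
      ((1 + 5 * X + 6 * X ^ 2 + X ^ 3) ^ 2 -
            C d * (X ^ 2 + 5 * X ^ 3 + 7 * X ^ 4 + 2 * X ^ 5))) := by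
  -- the coefficients are made homogeneous in `c`, `d`, `4 - c - d`
  obtain ⟨e, he⟩ : ∃ e, e = 4 - c - d := ⟨_, rfl⟩
  have he0 : 0 ≤ e := by linarith
  obtain ⟨T, hT⟩ : ∃ T, T = (c + d + e) / 4 := ⟨_, rfl⟩
  have hT1 : T = 1 := by rw [hT, he]; ring
  have hcd0 := mul_nonneg hc hd
  have h : ((1 + 5 * X + 6 * X ^ 2 + X ^ 3 : ℝ[X]) ^ 2 -
        C c * (X ^ 2 + 5 * X ^ 3 + 7 * X ^ 4 + 2 * X ^ 5)) *
      ((1 + 5 * X + 6 * X ^ 2 + X ^ 3) ^ 2 -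
            C d * (X ^ 2 + 5 * X ^ 3 + 7 * X ^ 4 + 2 * X ^ 5)) = polyOfList [
    1 * T ^ 2, 20 * T ^ 2, 174 * T ^ 2 - 1 * (T * (c + d)), 864 * T ^ 2 - 15 * (T * (c + d)),
    2701 * T ^ 2 - 94 * (T * (c + d)) + 1 * (c * d),
    5532 * T ^ 2 - 319 * (T * (c + d)) + 10 * (c * d),
    7490 * T ^ 2 - 635 * (T * (c + d)) + 39 * (c * d),
    6612 * T ^ 2 - 750 * (T * (c + d)) + 74 * (c * d),
    3678 * T ^ 2 - 507 * (T * (c + d)) + 69 * (c * d),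
    1228 * T ^ 2 - 181 * (T * (c + d)) + 28 * (c * d),
    236 * T ^ 2 - 31 * (T * (c + d)) + 4 * (c * d), 24 * T ^ 2 - 2 * (T * (c + d)), 1 * T ^ 2] := by
    rw [hT1]
    simp only [polyOfList, map_sub, map_add, map_mul, map_ofNat, map_one, map_pow]
    ring
  rw [h]
  refine LogConcave.of_list _ ?_
  simp only [ListLC]
  refine ⟨?_, ?_, ?_, ?_, ?_, ?_, ?_, ?_, ?_, ?_, ?_, ?_, ?_, ?_, ?_, ?_, ?_, ?_, ?_, ?_, ?_,
        ?_, ?_, ?_⟩ <;>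
  first
  | (rw [hT1]; linarith)
  | (rw [hT, ← sub_nonneg]; ring_nf; positivity)

theorem logConcave_path_seven_factor {c : ℝ} (hc : 0 ≤ c) (hc4 : c ≤ 4) :
    LogConcave ((1 + 7 * X + 15 * X ^ 2 + 10 * X ^ 3 + X ^ 4 : ℝ[X]) ^ 2 -
          C c * (X ^ 2 + 9 * X ^ 3 + 29 * X ^ 4 + 40 * X ^ 5 + 22 * X ^ 6 + 3 * X ^ 7)) := by
  have h : (1 + 7 * X + 15 * X ^ 2 + 10 * X ^ 3 + X ^ 4 : ℝ[X]) ^ 2 -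
        C c * (X ^ 2 + 9 * X ^ 3 + 29 * X ^ 4 + 40 * X ^ 5 + 22 * X ^ 6 + 3 * X ^ 7) = polyOfList [
    1 - c * 0, 14 - c * 0, 79 - c * 1, 230 - c * 9, 367 - c * 29, 314 - c * 40, 130 - c * 22,
    20 - c * 3, 1 - c * 0] := by
    simp only [polyOfList, map_sub, map_mul, map_ofNat, map_one, map_zero]
    ring
  rw [h]
  refine LogConcave.of_list _ ?_
  simp only [ListLC]
  refine ⟨?_, ?_, ?_, ?_, ?_, ?_, ?_, ?_, ?_, ?_, ?_, ?_, ?_, ?_, ?_, ?_⟩ <;>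
  first
  | (refine lc_of_bernstein hc hc4 ?_ ?_ ?_ <;> norm_num)
  | linarith

theorem logConcave_path_nine_factor {c : ℝ} (hc : 0 ≤ c) (hc4 : c ≤ 4) :
    LogConcave ((1 + 9 * X + 28 * X ^ 2 + 35 * X ^ 3 + 15 * X ^ 4 + X ^ 5 : ℝ[X]) ^ 2 -
          C c * (X ^ 2 + 13 * X ^ 3 + 67 * X ^ 4 + 174 * X ^ 5 + 239 * X ^ 6 + 166 * X ^ 7 +
          50 * X ^ 8 + 4 * X ^ 9)) := by
  have h : (1 + 9 * X + 28 * X ^ 2 + 35 * X ^ 3 + 15 * X ^ 4 + X ^ 5 : ℝ[X]) ^ 2 -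
        C c * (X ^ 2 + 13 * X ^ 3 + 67 * X ^ 4 + 174 * X ^ 5 + 239 * X ^ 6 + 166 * X ^ 7 +
        50 * X ^ 8 + 4 * X ^ 9) = polyOfList [
    1 - c * 0, 18 - c * 0, 137 - c * 1, 574 - c * 13, 1444 - c * 67, 2232 - c * 174,
    2083 - c * 239, 1106 - c * 166, 295 - c * 50, 30 - c * 4, 1 - c * 0] := by
    simp only [polyOfList, map_sub, map_mul, map_ofNat, map_one, map_zero]
    ring
  rw [h]
  refine LogConcave.of_list _ ?_
  simp only [ListLC]
  refine ⟨?_, ?_, ?_, ?_, ?_, ?_, ?_, ?_, ?_, ?_, ?_, ?_, ?_, ?_, ?_, ?_, ?_, ?_, ?_, ?_⟩ <;>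
  first
  | (refine lc_of_bernstein hc hc4 ?_ ?_ ?_ <;> norm_num)
  | linarith

theorem logConcave_doubleStar_zero_two_factor {c : ℝ} (hc : 0 ≤ c) (hc4 : c ≤ 4) :
    LogConcave ((1 + 4 * X + 3 * X ^ 2 + X ^ 3 : ℝ[X]) ^ 2 -
          C c * (X ^ 2 + 2 * X ^ 3 + X ^ 4)) := by
  have h : (1 + 4 * X + 3 * X ^ 2 + X ^ 3 : ℝ[X]) ^ 2 -
        C c * (X ^ 2 + 2 * X ^ 3 + X ^ 4) = polyOfList [
    1 - c * 0, 8 - c * 0, 22 - c * 1, 26 - c * 2, 17 - c * 1, 6 - c * 0, 1 - c * 0] := by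
    simp only [polyOfList, map_sub, map_mul, map_ofNat, map_one, map_zero]
    ring
  rw [h]
  refine LogConcave.of_list _ ?_
  simp only [ListLC]
  refine ⟨?_, ?_, ?_, ?_, ?_, ?_, ?_, ?_, ?_, ?_, ?_, ?_⟩ <;>
  first
  | (refine lc_of_bernstein hc hc4 ?_ ?_ ?_ <;> norm_num)
  | linarith

theorem logConcave_doubleStar_zero_three_factor {c : ℝ} (hc : 0 ≤ c) (hc4 : c ≤ 4) :
    LogConcave ((1 + 5 * X + 6 * X ^ 2 + 4 * X ^ 3 + X ^ 4 : ℝ[X]) ^ 2 -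
          C c * (X ^ 2 + 3 * X ^ 3 + 3 * X ^ 4 + X ^ 5)) := by
  have h : (1 + 5 * X + 6 * X ^ 2 + 4 * X ^ 3 + X ^ 4 : ℝ[X]) ^ 2 -
        C c * (X ^ 2 + 3 * X ^ 3 + 3 * X ^ 4 + X ^ 5) = polyOfList [
    1 - c * 0, 10 - c * 0, 37 - c * 1, 68 - c * 3, 78 - c * 3, 58 - c * 1, 28 - c * 0,
    8 - c * 0, 1 - c * 0] := by
    simp only [polyOfList, map_sub, map_mul, map_ofNat, map_one, map_zero]
    ring
  rw [h]
  refine LogConcave.of_list _ ?_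
  simp only [ListLC]
  refine ⟨?_, ?_, ?_, ?_, ?_, ?_, ?_, ?_, ?_, ?_, ?_, ?_, ?_, ?_, ?_, ?_⟩ <;>
  first
  | (refine lc_of_bernstein hc hc4 ?_ ?_ ?_ <;> norm_num)
  | linarith

/-! ### Quadratic factors of double stars -/

/-! In the lemmas below the numbers of pendant edges are `a` and `a + d`.
They concern the polynomials
`h = (1 + x)^a + x`, `w h`, `w h + 2 x`, `h (w h + 2 x)` and `h (w h + 2 x) - c x²`, where
`w = (1 + x)^d`. -/

theorem coeff_h (a : ℕ) : ((1 + X : ℝ[X]) ^ a + X).coeff 0 = 1 ∧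
    ((1 + X : ℝ[X]) ^ a + X).coeff 1 = (a : ℝ) + 1 ∧
    ∀ i, ((1 + X : ℝ[X]) ^ a + X).coeff (i + 2) = (a.choose (i + 2) : ℝ) := by
  refine ⟨?_, ?_, fun i => ?_⟩ <;> simp [coeff_one_add_X_pow, coeff_X]

theorem logConcave_h (a : ℕ) : LogConcave ((1 + X : ℝ[X]) ^ a + X) := by
  obtain ⟨h0, h1, h2⟩ := coeff_h a
  have := (Nat.cast_nonneg a : (0 : ℝ) ≤ a)
  refine (logConcave_one_add_X_pow a).update 1 (fun i hi => ?_) (by rw [h1]; positivity)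
    (fun i hi => ?_) (fun i hi _ => ?_)
  · simp [coeff_X, hi.symm]
  · obtain rfl : i = 0 := by omega
    simp [coeff_one_add_X_pow]
  · rcases a with _ | a
    · interval_cases i <;> simp [coeff_X, coeff_one]
    have := (Nat.cast_nonneg a : (0 : ℝ) ≤ a)
    interval_cases i
    · rw [h0, h1, h2, Nat.cast_choose_two]; push_cast; nlinarith
    · rw [h1, h2, h2, Nat.cast_choose_two, cast_choose_three, ← sub_nonneg]; push_cast
      ring_nf; positivity

theorem coeff_wh (a d : ℕ) : ((1 + X : ℝ[X]) ^ d * ((1 + X) ^ a + X)).coeff 0 = 1 ∧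
    ∀ i, ((1 + X : ℝ[X]) ^ d * ((1 + X) ^ a + X)).coeff (i + 1) =
      ((a + d).choose (i + 1) : ℝ) + d.choose i := by
  have : (1 + X : ℝ[X]) ^ d * ((1 + X) ^ a + X) = (1 + X) ^ (a + d) + (1 + X) ^ d * X := by ring
  rw [this]
  refine ⟨?_, fun i => ?_⟩ <;> simp [coeff_one_add_X_pow]

/-- The case `r = 2` occurs in the quadratic factors, the case `r = 1` in `p` itself. -/
theorem logConcave_wh_add (a d : ℕ) (r : ℝ) (hr : 0 ≤ r) (hr2 : r ≤ 2) :
    LogConcave ((1 + X : ℝ[X]) ^ d * ((1 + X) ^ a + X) + C r * X) := by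
  obtain ⟨h0, h1⟩ := coeff_wh a d
  have hlc := (logConcave_one_add_X_pow d).mul (logConcave_h a)
  set p := (1 + X : ℝ[X]) ^ d * ((1 + X) ^ a + X) with hp
  have e : ∀ i, i ≠ 1 → (p + C r * X).coeff i = p.coeff i := by
    intro i hi
    simp [coeff_X, hi.symm]
  have e1 : (p + C r * X).coeff 1 = p.coeff 1 + r := by simp
  have ha := (Nat.cast_nonneg a : (0 : ℝ) ≤ a)
  have hd := (Nat.cast_nonneg d : (0 : ℝ) ≤ d)
  refine hlc.update 1 e ?_ (fun i hi => ?_) (fun i hi _ => ?_)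
  · rw [e1, h1]; simp; positivity
  · obtain rfl : i = 0 := by omega
    rw [h0]; norm_num
  · interval_cases i
    · rw [e 0 (by omega), e 2 (by omega), e1, h0, h1, h1, Nat.cast_choose_two]
      simp only [Nat.choose_one_right, Nat.choose_zero_right, zero_add]
      push_cast
      nlinarith [mul_nonneg hr ha, mul_nonneg hr hd, mul_nonneg ha hd]
    · rw [e1, e 2 (by omega), e 3 (by omega)]
      have key : (p.coeff 1 + 2) * p.coeff 3 ≤ p.coeff 2 ^ 2 := by
        rw [h1, h1, h1, Nat.cast_choose_two, cast_choose_three, Nat.cast_choose_two]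
        simp only [Nat.choose_one_right, Nat.choose_zero_right, zero_add]
        push_cast
        rcases a with _ | a
        · rw [← sub_nonneg]
          ring_nf; positivity
        · rw [← sub_nonneg]
          have := (Nat.cast_nonneg a : (0 : ℝ) ≤ a)
          -- the square absorbs the negative term `-a³ / 6` of the expansion
          refine nonneg_of_nonneg_sub (y := (a * (a - 1)) ^ 2 / 12) (by positivity) ?_
          push_cast; ring_nf; positivity
      have := hlc.nonneg 3
      nlinarith

/-- The first coefficients of `h (w h + 2 x)`. -/
theorem coeff_doubleStar_main (a d : ℕ) :
    let s := ((1 + X : ℝ[X]) ^ a + X) * ((1 + X) ^ d * ((1 + X) ^ a + X) + C 2 * X)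
    let A : ℝ := a
    let D : ℝ := d
    let N : ℝ := A + D
    let q2 := N * (N - 1) / 2 + D
    let q3 := N * (N - 1) * (N - 2) / 6 + D * (D - 1) / 2
    let q4 := N * (N - 1) * (N - 2) * (N - 3) / 24 + D * (D - 1) * (D - 2) / 6
    s.coeff 0 = 1 ∧ s.coeff 1 = (N + 3) + (A + 1) ∧
    s.coeff 2 = q2 + (A + 1) * (N + 3) + A * (A - 1) / 2 ∧
    s.coeff 3 = q3 + (A + 1) * q2 + A * (A - 1) / 2 * (N + 3) + A * (A - 1) * (A - 2) / 6 ∧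
    s.coeff 4 = q4 + (A + 1) * q3 + A * (A - 1) / 2 * q2 + A * (A - 1) * (A - 2) / 6 * (N + 3)
      + A * (A - 1) * (A - 2) * (A - 3) / 24 := by
  intro s A D N q2 q3 q4
  obtain ⟨h0, h1, h2⟩ := coeff_h a
  obtain ⟨k0, k1⟩ := coeff_wh a d
  simp only [s, mul_coeff_zero, coeff_mul_one, coeff_mul_two, coeff_mul_three, coeff_mul_four]
  simp only [coeff_add, coeff_C_mul, h0, h1, h2 0, h2 1, h2 2, k0, k1 0, k1 1, k1 2, k1 3]
  have x2 : ∀ i, (X : ℝ[X]).coeff (i + 2) = 0 := fun i => coeff_X_of_ne_one (by omega)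
  simp only [coeff_X_zero, coeff_X_one, x2 0, x2 1, x2 2, cast_choose_three, cast_choose_four,
    Nat.cast_choose_two, Nat.cast_add, zero_add, Nat.choose_one_right, Nat.choose_zero_right,
    Nat.reduceAdd, Nat.cast_one]
  simp only [A, D, N, q2, q3, q4]
  refine ⟨?_, ?_, ?_, ?_, ?_⟩ <;> ring

theorem logConcave_doubleStar_main_sub (a d : ℕ) (had : 1 ≤ a ∨ a = 0 ∧ 4 ≤ d) {c : ℝ} (hc : 0 ≤ c)
    (hc4 : c ≤ 4) :
    LogConcave (((1 + X : ℝ[X]) ^ a + X) * ((1 + X) ^ d * ((1 + X) ^ a + X) + C 2 * X)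
      - C c * X ^ 2) := by
  obtain ⟨h0, h1, h2, h3, h4⟩ := coeff_doubleStar_main a d
  have hlc := (logConcave_h a).mul (logConcave_wh_add a d 2 (by norm_num) le_rfl)
  set s := ((1 + X : ℝ[X]) ^ a + X) * ((1 + X) ^ d * ((1 + X) ^ a + X) + C 2 * X) with hs
  have e : ∀ i, i ≠ 2 → (s - C c * X ^ 2).coeff i = s.coeff i := by
    intro i hi
    simp [coeff_X_pow, hi]
  have e2 : (s - C c * X ^ 2).coeff 2 = s.coeff 2 - c := by simp
  have ha := (Nat.cast_nonneg a : (0 : ℝ) ≤ a)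
  have hd := (Nat.cast_nonneg d : (0 : ℝ) ≤ d)
  have hpos : 0 < s.coeff 2 - 4 := by
    rw [h2]
    rcases had with had | ⟨rfl, had⟩
    · obtain ⟨b, rfl⟩ := Nat.exists_eq_add_of_le had
      have := (Nat.cast_nonneg b : (0 : ℝ) ≤ b)
      push_cast; ring_nf; positivity
    · obtain ⟨b, rfl⟩ := Nat.exists_eq_add_of_le had
      have := (Nat.cast_nonneg b : (0 : ℝ) ≤ b)
      push_cast; ring_nf; positivity
  refine hlc.update 2 e (by rw [e2]; linarith) (fun i hi => ?_) (fun i hi _ => ?_)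
  · interval_cases i
    · rw [h0]; norm_num
    · rw [h1]; positivity
  · interval_cases i
    · rw [e 0 (by omega), e 1 (by omega), e2]
      have := hlc.lc 0
      rw [h0] at this ⊢
      linarith
    · rw [e 1 (by omega), e 3 (by omega), e2]
      have key : s.coeff 1 * s.coeff 3 ≤ (s.coeff 2 - 4) ^ 2 := by
        rw [h1, h2, h3, ← sub_nonneg]
        rcases had with had | ⟨rfl, had⟩
        · obtain ⟨b, rfl⟩ := Nat.exists_eq_add_of_le had
          have := (Nat.cast_nonneg b : (0 : ℝ) ≤ b)
          push_cast; ring_nf; positivity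
        · obtain ⟨b, rfl⟩ := Nat.exists_eq_add_of_le had
          have := (Nat.cast_nonneg b : (0 : ℝ) ≤ b)
          push_cast; ring_nf; positivity
      nlinarith
    · rw [e 3 (by omega), e 4 (by omega), e2]
      have := hlc.lc 2
      have := hlc.nonneg 4
      nlinarith

set_option maxHeartbeats 1000000 in
/-- The quadratic factor of a double star, divided by `(1 + x)^(2a)`. -/
theorem logConcave_doubleStar_factor (a d : ℕ) (had : 1 ≤ a ∨ a = 0 ∧ 4 ≤ d) {c : ℝ}
    (hc : 0 ≤ c) (hc4 : c ≤ 4) :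
    LogConcave ((1 + X : ℝ[X]) ^ d *
      (((1 + X : ℝ[X]) ^ a + X) * ((1 + X) ^ d * ((1 + X) ^ a + X) + C 2 * X) - C c * X ^ 2)
      + X ^ 2) := by
  obtain ⟨h0, h1, h2, h3, h4⟩ := coeff_doubleStar_main a d
  have hlc := (logConcave_one_add_X_pow d).mul (logConcave_doubleStar_main_sub a d had hc hc4)
  set s := ((1 + X : ℝ[X]) ^ a + X) * ((1 + X) ^ d * ((1 + X) ^ a + X) + C 2 * X) with hs
  set t := (1 + X : ℝ[X]) ^ d * (s - C c * X ^ 2) with ht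
  have ha := (Nat.cast_nonneg a : (0 : ℝ) ≤ a)
  have hd := (Nat.cast_nonneg d : (0 : ℝ) ≤ d)
  have e : ∀ i, i ≠ 2 → (t + X ^ 2).coeff i = t.coeff i := by
    intro i hi
    simp [coeff_X_pow, hi]
  have e2 : (t + X ^ 2).coeff 2 = t.coeff 2 + 1 := by simp
  have t0 : t.coeff 0 = 1 := by
    simp [ht, mul_coeff_zero, h0, coeff_one_add_X_pow]
  have t1 : t.coeff 1 = s.coeff 1 + d := by
    rw [ht, coeff_mul_one]
    simp [coeff_one_add_X_pow, h0, coeff_X_pow]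
  have t2 : t.coeff 2 = s.coeff 2 + d * s.coeff 1 + d * (d - 1) / 2 - c * 1 := by
    rw [ht, coeff_mul_two]
    simp [coeff_one_add_X_pow, h0, coeff_X_pow, Nat.cast_choose_two]; ring
  have t3 : t.coeff 3 = s.coeff 3 + d * s.coeff 2 + d * (d - 1) / 2 * s.coeff 1
      + d * (d - 1) * (d - 2) / 6 - c * d := by
    rw [ht, coeff_mul_three]
    simp [coeff_one_add_X_pow, h0, coeff_X_pow, Nat.cast_choose_two, cast_choose_three]; ring
  have t4 : t.coeff 4 = s.coeff 4 + d * s.coeff 3 + d * (d - 1) / 2 * s.coeff 2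
      + d * (d - 1) * (d - 2) / 6 * s.coeff 1 + d * (d - 1) * (d - 2) * (d - 3) / 24
      - c * (d * (d - 1) / 2) := by
    rw [ht, coeff_mul_four]
    simp [coeff_one_add_X_pow, h0, coeff_X_pow, Nat.cast_choose_two, cast_choose_three,
      cast_choose_four]; ring
  have hn2 := hlc.nonneg 2
  refine hlc.update 2 e (by rw [e2]; linarith) (fun i hi => ?_) (fun i hi _ => ?_)
  · interval_cases i
    · rw [t0]; norm_num
    · rw [t1, h1]; positivity
  · interval_cases i
    · rw [e 0 (by omega), e 1 (by omega), e2, t0, t1, t2, h1, h2, ← sub_nonneg]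
      refine nonneg_of_nonneg_sub hc ?_
      ring_nf
      positivity
    · rw [e 1 (by omega), e 3 (by omega), e2]
      have := hlc.lc 1
      nlinarith
    · rw [e 3 (by omega), e 4 (by omega), e2, t2, t3, t4, sub_add_eq_add_sub]
      rw [h1, h2, h3, h4]
      rcases had with had | ⟨rfl, had⟩
      · obtain ⟨b, rfl⟩ := Nat.exists_eq_add_of_le had
        have := (Nat.cast_nonneg b : (0 : ℝ) ≤ b)
        refine lc_of_bernstein hc hc4 ?_ ?_ ?_ <;>
        · push_cast; ring_nf; positivity
      · obtain ⟨b, rfl⟩ := Nat.exists_eq_add_of_le had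
        have := (Nat.cast_nonneg b : (0 : ℝ) ≤ b)
        refine lc_of_bernstein hc hc4 ?_ ?_ ?_ <;>
        · push_cast; ring_nf; positivity

/-- The polynomials of the double star satisfy the hypothesis of the factorization argument. Here
`a` and `a + d` are the numbers of pendant edges at the two centres. -/
theorem continuantLogConcave_doubleStar (a d : ℕ) : ContinuantLogConcave
    ((1 + X : ℝ[X]) ^ (a + (a + d)) + X * (1 + X) ^ (a + d) + X * (1 + X) ^ a)
    (X * (1 + X) ^ (a + d) * (X * (1 + X) ^ a)) := by
  have hp : (1 + X : ℝ[X]) ^ (a + (a + d)) + X * (1 + X) ^ (a + d) + X * (1 + X) ^ a =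
      (1 + X) ^ a * ((1 + X) ^ d * ((1 + X) ^ a + X) + C 1 * X) := by
    rw [map_one]; ring
  have hbase : LogConcave ((1 + X : ℝ[X]) ^ (a + (a + d)) + X * (1 + X) ^ (a + d)
      + X * (1 + X) ^ a) := by
    rw [hp]
    exact (logConcave_one_add_X_pow a).mul (logConcave_wh_add a d 1 (by norm_num) (by norm_num))
  by_cases had : 1 ≤ a ∨ a = 0 ∧ 4 ≤ d
  · refine ContinuantLogConcave.of_single hbase fun c hc hc4 => ?_
    have : ((1 + X : ℝ[X]) ^ (a + (a + d)) + X * (1 + X) ^ (a + d) + X * (1 + X) ^ a) ^ 2 -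
        C c * (X * (1 + X) ^ (a + d) * (X * (1 + X) ^ a)) =
        (1 + X) ^ a * (1 + X) ^ a * ((1 + X) ^ d *
          (((1 + X : ℝ[X]) ^ a + X) * ((1 + X) ^ d * ((1 + X) ^ a + X) + C 2 * X) - C c * X ^ 2)
          + X ^ 2) := by
      rw [map_ofNat]; ring
    rw [this]
    exact ((logConcave_one_add_X_pow a).mul (logConcave_one_add_X_pow a)).mul
      (logConcave_doubleStar_factor a d had hc hc4)
  · obtain ⟨rfl, hd⟩ : a = 0 ∧ d < 4 := by omega
    interval_cases d
    · refine ContinuantLogConcave.of_single hbase fun c hc hc4 => ?_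
      convert logConcave_path_two_factor hc hc4 using 2 <;> ring
    · refine ⟨hbase, fun c hc hc2 => ?_, fun c d hc hd hcd => ?_⟩
      · convert logConcave_path_three_factor hc hc2 using 2 <;> ring
      · convert logConcave_path_three_factor_mul hc hd hcd using 2 <;> ring
    · refine ContinuantLogConcave.of_single hbase fun c hc hc4 => ?_
      convert logConcave_doubleStar_zero_two_factor hc hc4 using 2 <;> ring
    · refine ContinuantLogConcave.of_single hbase fun c hc hc4 => ?_
      convert logConcave_doubleStar_zero_three_factor hc hc4 using 2 <;> ring

/-! ### Fibonacci polynomials and quadratic factors of paths -/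

/-- The Fibonacci polynomials `F₀ = 0`, `F₁ = 1`, `F_{n+2} = F_{n+1} + x F_n`; the independence
polynomial of the path on `n` vertices is `F_{n+2}`. -/
noncomputable def fibPoly : ℕ → ℝ[X]
  | 0 => 0
  | 1 => 1
  | n + 2 => fibPoly (n + 1) + X * fibPoly n

theorem fibPoly_add_two (n : ℕ) : fibPoly (n + 2) = fibPoly (n + 1) + X * fibPoly n := rfl

theorem coeff_fibPoly_succ (n j : ℕ) : (fibPoly (n + 1)).coeff j = ((n - j).choose j : ℝ) := by
  induction n using Nat.twoStepInduction generalizing j with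
  | zero => rcases j with _ | j <;> simp [fibPoly, coeff_one]
  | one => rcases j with _ | j <;> simp [fibPoly, coeff_one]
  | more n h0 h1 =>
    rw [fibPoly_add_two, coeff_add]
    rcases j with _ | j
    · simp [h1]
    · rw [h1, coeff_X_mul, h0, ← Nat.cast_add]
      congr 1
      rcases le_or_gt j n with h | h
      · rw [show n + 2 - (j + 1) = (n - j) + 1 by omega, Nat.choose_succ_succ,
          show n + 1 - (j + 1) = n - j by omega, add_comm]
      · rw [show n - j = 0 by omega, show n + 1 - (j + 1) = 0 by omega,
          Nat.choose_eq_zero_of_lt (show 0 < j + 1 by omega),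
          Nat.choose_eq_zero_of_lt (show 0 < j by omega), Nat.choose_eq_zero_of_lt (by omega)]

/-- Cassini's identity. -/
theorem fibPoly_cassini (n : ℕ) :
    fibPoly (n + 1) ^ 2 - fibPoly n * fibPoly (n + 1) - X * fibPoly n ^ 2 = (-X) ^ n := by
  induction n with
  | zero => simp [fibPoly]
  | succ n ih => rw [pow_succ (-X) n, ← ih, fibPoly_add_two]; ring

/-- The quadratic factor of the path is, up to a monomial, a product of two polynomials with
explicit coefficients. -/
theorem fibPoly_factor (k : ℕ) (c : ℝ[X]) :
    fibPoly (k + 3) ^ 2 - c * (X ^ 2 * fibPoly (k + 1) * fibPoly k) =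
      fibPoly (k + 1) * (fibPoly (k + 5) - c * (X ^ 2 * fibPoly k)) + (-X) ^ (k + 1) := by
  have h := fibPoly_cassini (k + 1)
  rw [fibPoly_add_two (k + 3), fibPoly_add_two (k + 2), fibPoly_add_two (k + 1), ← h]
  ring

theorem cast_choose_pos {n k : ℕ} (h : k ≤ n) : (0 : ℝ) < n.choose k := by
  exact_mod_cast Nat.choose_pos h

theorem cast_add_choose_eq (a b : ℕ) :
    ((a + b).choose a : ℝ) = (a + b).factorial / (a.factorial * b.factorial) := by
  rw [eq_div_iff (by positivity), ← mul_assoc, Nat.choose_symm_add]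
  exact_mod_cast Nat.add_choose_mul_factorial_mul_factorial a b

/-- A positive common factor of three consecutive coefficients can be ignored. -/
theorem lc_of_proportional {K a b c x y z : ℝ} (hK : 0 < K) (ha : a = K * x) (hb : b = K * y)
    (hc : c = K * z) (h : x * z ≤ y ^ 2) : a * c ≤ b ^ 2 := by
  rw [ha, hb, hc]
  nlinarith [mul_le_mul_of_nonneg_left h (mul_pos hK hK).le]

theorem logConcave_fibPoly (n : ℕ) : LogConcave (fibPoly (n + 1)) := by
  refine LogConcave.of_pos (n / 2) (fun i hi => ?_) ?_ (fun i hi => ?_) (fun i hi => ?_)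
  · rw [coeff_fibPoly_succ]; exact cast_choose_pos (by omega)
  · rw [coeff_fibPoly_succ]; positivity
  · rw [coeff_fibPoly_succ, Nat.choose_eq_zero_of_lt (by omega)]; simp
  · obtain ⟨s, rfl⟩ : ∃ s, n = 2 * i + 4 + s := ⟨n - 2 * i - 4, by omega⟩
    simp only [coeff_fibPoly_succ]
    rw [show 2 * i + 4 + s - i = i + (s + 4) by omega,
      show 2 * i + 4 + s - (i + 1) = (i + 1) + (s + 2) by omega,
      show 2 * i + 4 + s - (i + 2) = (i + 2) + s by omega,
      cast_add_choose_eq, cast_add_choose_eq, cast_add_choose_eq,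
      show i + (s + 4) = i + s + 2 + 1 + 1 by ring, show i + 1 + (s + 2) = i + s + 2 + 1 by ring,
      show i + 2 + s = i + s + 2 by ring]
    simp only [Nat.factorial_succ]
    push_cast
    have hK : (0 : ℝ) < (i + s + 2).factorial / (i.factorial * s.factorial) := by positivity
    rw [Nat.factorial_succ, Nat.factorial_succ] at hK
    push_cast at hK
    refine lc_of_proportional hK
      (x := (i + s + 4) * (i + s + 3) / ((s + 4) * (s + 3) * (s + 2) * (s + 1)))
      (y := (i + s + 3) / ((i + 1) * (s + 2) * (s + 1))) (z := 1 / ((i + 2) * (i + 1)))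
      ?_ ?_ ?_ ?_
    · field_simp; ring
    · field_simp; ring
    · field_simp; ring
    · rw [div_mul_div_comm, div_pow, div_le_div_iff₀ (by positivity) (by positivity),
        ← sub_nonneg]
      ring_nf
      positivity

/-- The polynomial `F_{n+6} - c x² F_{n+1}`, the main part of the quadratic factor of a path. -/
noncomputable def pathCofactor (n : ℕ) (c : ℝ) : ℝ[X] :=
  fibPoly (n + 6) - C c * (X ^ 2 * fibPoly (n + 1))

theorem coeff_pathCofactor_zero (n : ℕ) (c : ℝ) : (pathCofactor n c).coeff 0 = 1 := by
  simp [pathCofactor, coeff_fibPoly_succ, mul_coeff_zero]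

theorem coeff_pathCofactor_one (n : ℕ) (c : ℝ) : (pathCofactor n c).coeff 1 = n + 4 := by
  rw [pathCofactor, coeff_sub, coeff_fibPoly_succ, coeff_C_mul, coeff_X_pow_mul']
  simp

theorem coeff_pathCofactor (n j : ℕ) (c : ℝ) : (pathCofactor n c).coeff (j + 2) =
    ((n + 3 - j).choose (j + 2) : ℝ) - c * ((n - j).choose j : ℝ) := by
  rw [pathCofactor, coeff_sub, coeff_fibPoly_succ, coeff_C_mul, coeff_X_pow_mul,
    coeff_fibPoly_succ, show n + 5 - (j + 2) = n + 3 - j by omega]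

/-- The polynomial factor in `C(r + j + 1, j) - c C(r + j - 2, j - 2)`, with `j = i + 2`. -/
def pathD (c i r : ℝ) : ℝ :=
  (r + i + 3) * (r + i + 2) * (r + i + 1) - c * ((i + 2) * (i + 1) * (r + 1))

/-! Three consecutive coefficients of `pathCofactor n c`, where `n = 2 i + s + 1`,
as multiples of the
binomial coefficient `C(i + s + 1, i)`. -/

section
variable (i s : ℕ) (c : ℝ)

theorem coeff_pathCofactor_prev : (pathCofactor (2 * i + s + 1) c).coeff (i + 1) =
    ((i + s + 1).factorial / (i.factorial * (s + 1).factorial) : ℝ) *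
      ((i + s + 2) / ((i + 1) * (s + 2) * (s + 3) * (s + 4)) * pathD c (i - 1) (s + 3)) := by
  rcases i with _ | i
  · rw [zero_add, coeff_pathCofactor_one]
    simp only [pathD, Nat.factorial_succ, zero_add, Nat.factorial_zero]
    push_cast
    field_simp
    ring
  · rw [coeff_pathCofactor, show 2 * (i + 1) + s + 1 + 3 - i = (i + 2) + (s + 4) by omega,
      show 2 * (i + 1) + s + 1 - i = i + (s + 3) by omega, cast_add_choose_eq, cast_add_choose_eq,
      show i + 2 + (s + 4) = i + s + 1 + 1 + 1 + 1 + 1 + 1 by ring,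
      show i + (s + 3) = i + s + 1 + 1 + 1 by ring, show i + 1 + s + 1 = i + s + 1 + 1 by ring]
    simp only [pathD, Nat.factorial_succ]
    push_cast
    field_simp
    ring

theorem coeff_pathCofactor_mid : (pathCofactor (2 * i + s + 1) c).coeff (i + 2) =
    ((i + s + 1).factorial / (i.factorial * (s + 1).factorial) : ℝ) *
      (1 / ((i + 1) * (i + 2) * (s + 2)) * pathD c i (s + 1)) := by
  rw [coeff_pathCofactor, show 2 * i + s + 1 + 3 - i = (i + 2) + (s + 2) by omega,
    show 2 * i + s + 1 - i = i + (s + 1) by omega, cast_add_choose_eq, cast_add_choose_eq,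
    show i + 2 + (s + 2) = i + s + 1 + 1 + 1 + 1 by ring, show i + (s + 1) = i + s + 1 by ring]
  simp only [pathD, Nat.factorial_succ]
  push_cast
  field_simp
  ring

theorem coeff_pathCofactor_next : (pathCofactor (2 * i + s + 1) c).coeff (i + 3) =
    ((i + s + 1).factorial / (i.factorial * (s + 1).factorial) : ℝ) *
      ((s + 1) / ((i + 1) * (i + 2) * (i + 3) * (i + s + 1)) * pathD c (i + 1) (s - 1)) := by
  rw [coeff_pathCofactor (j := i + 1),
    show 2 * i + s + 1 + 3 - (i + 1) = (i + 1 + 2) + s by omega,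
    show 2 * i + s + 1 - (i + 1) = i + s by omega, cast_add_choose_eq]
  rcases s with _ | s
  · rw [add_zero i, Nat.choose_eq_zero_of_lt (show i < i + 1 by omega)]
    simp only [pathD, Nat.factorial_succ, add_zero, Nat.factorial_zero]
    push_cast
    field_simp
    ring
  · rw [show i + (s + 1) = (i + 1) + s by ring, cast_add_choose_eq,
      show i + 1 + 2 + (s + 1) = i + s + 1 + 1 + 1 + 1 by ring,
      show i + 1 + s = i + s + 1 by ring]
    simp only [pathD, Nat.factorial_succ]
    push_cast
    field_simp
    ring

end

theorem pathD_pos {i s c : ℝ} (hi : 0 ≤ i) (hs : 0 ≤ s) (hc4 : c ≤ 4) :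
    0 < pathD c i (s + 1) := by
  have h : 0 < pathD 4 i (s + 1) := by
    -- the square absorbs the negative term `-i² s` of the expansion
    have : 0 ≤ i * (2 * i - s) ^ 2 / 4 := by positivity
    have : 0 < pathD 4 i (s + 1) - i * (2 * i - s) ^ 2 / 4 := by
      unfold pathD; ring_nf; positivity
    linarith
  have h2 : 0 ≤ (4 - c) * ((i + 2) * (i + 1) * (s + 1 + 1)) :=
    mul_nonneg (by linarith) (by positivity)
  unfold pathD at h ⊢
  linarith

/-- The Bernstein coefficients of the log-concavity inequality for `pathD`. -/
theorem pathD_lc_of_bernstein {i s c : ℝ} (hc : 0 ≤ c) (hc4 : c ≤ 4)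
    (h : 0 ≤ (i + 3) * (s + 3) * (s + 4) * (s + i + 1) * pathD 0 i (s + 1) ^ 2
        - (s + i + 2) * (s + 1) * (i + 2) * (s + 2) *
          (pathD 0 (i - 1) (s + 3) * pathD 0 (i + 1) (s - 1)) ∧
      0 ≤ (i + 3) * (s + 3) * (s + 4) * (s + i + 1) *
          (2 * pathD 0 i (s + 1) * pathD 4 i (s + 1))
        - (s + i + 2) * (s + 1) * (i + 2) * (s + 2) *
          (pathD 0 (i - 1) (s + 3) * pathD 4 (i + 1) (s - 1) +
            pathD 4 (i - 1) (s + 3) * pathD 0 (i + 1) (s - 1)) ∧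
      0 ≤ (i + 3) * (s + 3) * (s + 4) * (s + i + 1) * pathD 4 i (s + 1) ^ 2
        - (s + i + 2) * (s + 1) * (i + 2) * (s + 2) *
          (pathD 4 (i - 1) (s + 3) * pathD 4 (i + 1) (s - 1))) :
    (s + i + 2) * (s + 1) * (i + 2) * (s + 2) *
        (pathD c (i - 1) (s + 3) * pathD c (i + 1) (s - 1)) ≤
      (i + 3) * (s + 3) * (s + 4) * (s + i + 1) * pathD c i (s + 1) ^ 2 := by
  simp only [pathD, zero_mul, sub_zero] at h ⊢
  exact weighted_lc_of_bernstein hc hc4 h.1 h.2.1 h.2.2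

set_option maxHeartbeats 1000000 in
/-- The case in which, in the notation of `pathD`, `j ≥ 4` and `r ≥ 2`. -/
theorem pathD_lc_generic {i s c : ℝ} (hi : 0 ≤ i) (hs : 0 ≤ s) (hc : 0 ≤ c) (hc4 : c ≤ 4) :
    (s + 1 + (i + 2) + 2) * (s + 1 + 1) * (i + 2 + 2) * (s + 1 + 2) *
        (pathD c (i + 2 - 1) (s + 1 + 3) * pathD c (i + 2 + 1) (s + 1 - 1)) ≤
      (i + 2 + 3) * (s + 1 + 3) * (s + 1 + 4) * (s + 1 + (i + 2) + 1) *
        pathD c (i + 2) (s + 1 + 1) ^ 2 := by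
  refine pathD_lc_of_bernstein hc hc4 ⟨?_, ?_, ?_⟩
  · unfold pathD; ring_nf; positivity
  · unfold pathD; ring_nf; positivity
  · -- the only negative term of the expansion is `-4 i ^ 7 s ^ 2`
    refine nonneg_of_nonneg_sub (y := 2 * i ^ 6 * s * (s - i) ^ 2) (by positivity) ?_
    unfold pathD; ring_nf; positivity

/-- The case `r = 1`, in which the last of the three coefficients is the leading one. -/
theorem pathD_lc_boundary {i c : ℝ} (hi : 0 ≤ i) (hc : 0 ≤ c) (hc4 : c ≤ 4) :
    (0 + (i + 4) + 2) * (0 + 1) * (i + 4 + 2) * (0 + 2) *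
        (pathD c (i + 4 - 1) (0 + 3) * pathD c (i + 4 + 1) (0 - 1)) ≤
      (i + 4 + 3) * (0 + 3) * (0 + 4) * (0 + (i + 4) + 1) * pathD c (i + 4) (0 + 1) ^ 2 := by
  refine pathD_lc_of_bernstein hc hc4 ⟨?_, ?_, ?_⟩ <;>
  · unfold pathD; ring_nf; positivity

/-- The log-concavity inequality for the coefficients of `pathCofactor n c`, `n = 2 i + s + 1`,
without their common factors. -/
theorem pathD_lc {c : ℝ} (hc : 0 ≤ c) (hc4 : c ≤ 4) (i s : ℕ)
    (h : 9 ≤ 2 * i + s + 1 ∨ Even (2 * i + s + 1) ∧ 4 ≤ 2 * i + s + 1) :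
    ((s : ℝ) + i + 2) * (s + 1) * (i + 2) * (s + 2) *
        (pathD c (i - 1) (s + 3) * pathD c (i + 1) (s - 1)) ≤
      (i + 3) * (s + 3) * (s + 4) * (s + i + 1) * pathD c i (s + 1) ^ 2 := by
  rw [Nat.even_iff] at h
  obtain rfl | rfl | hi : i = 0 ∨ i = 1 ∨ 2 ≤ i := by omega
  · refine pathD_lc_of_bernstein hc hc4 ?_
    obtain rfl | rfl | hs : s = 3 ∨ s = 5 ∨ 7 ≤ s := by omega
    · norm_num [pathD]
    · norm_num [pathD]
    · obtain ⟨t, rfl⟩ := Nat.exists_eq_add_of_le hs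
      have := (Nat.cast_nonneg t : (0 : ℝ) ≤ t)
      unfold pathD; push_cast
      refine ⟨?_, ?_, ?_⟩ <;> · ring_nf; positivity
  · refine pathD_lc_of_bernstein hc hc4 ?_
    obtain rfl | rfl | hs : s = 1 ∨ s = 3 ∨ 5 ≤ s := by omega
    · norm_num [pathD]
    · norm_num [pathD]
    · obtain ⟨t, rfl⟩ := Nat.exists_eq_add_of_le hs
      have := (Nat.cast_nonneg t : (0 : ℝ) ≤ t)
      unfold pathD; push_cast
      refine ⟨?_, ?_, ?_⟩ <;> · ring_nf; positivity
  · rcases s with _ | s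
    · obtain ⟨i, rfl⟩ := Nat.exists_eq_add_of_le' (show 4 ≤ i by omega)
      have := pathD_lc_boundary (Nat.cast_nonneg i) hc hc4
      exact_mod_cast this
    · obtain ⟨i, rfl⟩ := Nat.exists_eq_add_of_le' hi
      have := pathD_lc_generic (Nat.cast_nonneg i) (Nat.cast_nonneg s) hc hc4
      exact_mod_cast this

theorem logConcave_pathCofactor {c : ℝ} (hc : 0 ≤ c) (hc4 : c ≤ 4) (n : ℕ)
    (h : 9 ≤ n ∨ Even n ∧ 4 ≤ n) : LogConcave (pathCofactor n c) := by
  refine LogConcave.of_pos ((n + 5) / 2) (fun j hj => ?_) ?_ (fun j hj => ?_) (fun j hj => ?_)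
  · obtain rfl | rfl | hj2 : j = 0 ∨ j = 1 ∨ 2 ≤ j := by omega
    · rw [coeff_pathCofactor_zero]; norm_num
    · rw [coeff_pathCofactor_one]; positivity
    · obtain ⟨i, rfl⟩ := Nat.exists_eq_add_of_le' hj2
      obtain hn | ⟨s, rfl⟩ : n = 2 * i ∨ ∃ s, n = 2 * i + s + 1 := by
        rcases Nat.lt_or_ge (2 * i) n with h | h
        · exact Or.inr ⟨n - 2 * i - 1, by omega⟩
        · exact Or.inl (by omega)
      · omega
      · rw [coeff_pathCofactor_mid]
        have := pathD_pos (Nat.cast_nonneg i) (Nat.cast_nonneg s) hc4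
        positivity
  · rw [show (n + 5) / 2 = (n + 1) / 2 + 2 by omega, coeff_pathCofactor]
    rcases Nat.even_or_odd' n with ⟨m, rfl | rfl⟩
    · rw [show (2 * m + 1) / 2 = m by omega, show 2 * m + 3 - m = m + 2 + 1 by omega,
        show 2 * m - m = m by omega, Nat.choose_self, Nat.choose_succ_self_right]
      have : (2 : ℝ) ≤ m := by exact_mod_cast (show 2 ≤ m by omega)
      push_cast; linarith
    · rw [show (2 * m + 1 + 1) / 2 = m + 1 by omega,
        show 2 * m + 1 + 3 - (m + 1) = m + 1 + 2 by omega, show 2 * m + 1 - (m + 1) = m by omega,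
        Nat.choose_self, Nat.choose_succ_self]
      simp
  · obtain ⟨i, rfl⟩ := Nat.exists_eq_add_of_le' (show 2 ≤ j by omega)
    rw [coeff_pathCofactor, Nat.choose_eq_zero_of_lt (by omega),
      Nat.choose_eq_zero_of_lt (by omega)]
    simp
  · rcases j with _ | i
    · rw [coeff_pathCofactor_zero, coeff_pathCofactor_one, coeff_pathCofactor,
        Nat.sub_zero, Nat.sub_zero, zero_add, Nat.cast_choose_two, Nat.choose_zero_right]
      push_cast
      have := (Nat.cast_nonneg n : (0 : ℝ) ≤ n)
      nlinarith
    · obtain ⟨s, rfl⟩ : ∃ s, n = 2 * i + s + 1 := ⟨n - 2 * i - 1, by omega⟩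
      have key := pathD_lc hc hc4 i s h
      refine lc_of_proportional (by positivity) (coeff_pathCofactor_prev i s c)
        (coeff_pathCofactor_mid i s c) (coeff_pathCofactor_next i s c) ?_
      have hs1 : (0 : ℝ) < s + 1 := by positivity
      have hi1 : (0 : ℝ) < i + 1 := by positivity
      set W : ℝ := (i + 1) ^ 2 * (i + 2) ^ 2 * (i + 3) * (s + 2) ^ 2 * (s + 3) * (s + 4) *
        (s + i + 1) with hW
      calc _ = ((s : ℝ) + i + 2) * (s + 1) * (i + 2) * (s + 2) *
            (pathD c (i - 1) (s + 3) * pathD c (i + 1) (s - 1)) / W := by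
            rw [hW]; field_simp; ring
        _ ≤ (i + 3) * (s + 3) * (s + 4) * (s + i + 1) * pathD c i (s + 1) ^ 2 / W := by gcongr
        _ = _ := by rw [hW]; field_simp

section top
variable {p q : ℝ[X]} {a b : ℕ}

/-- The three top coefficients of a product, obtained from the reversed polynomials. -/
theorem coeff_mul_top (hp : p.natDegree ≤ a + 2) (hq : q.natDegree ≤ b + 2) :
    (p * q).coeff (a + b + 4) = p.coeff (a + 2) * q.coeff (b + 2) ∧
    (p * q).coeff (a + b + 3) =
      p.coeff (a + 2) * q.coeff (b + 1) + p.coeff (a + 1) * q.coeff (b + 2) ∧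
    (p * q).coeff (a + b + 2) = p.coeff (a + 2) * q.coeff b + p.coeff (a + 1) * q.coeff (b + 1) +
      p.coeff a * q.coeff (b + 2) := by
  have h := reflect_mul p q hp hq
  have e : ∀ (r : ℝ[X]) (N i : ℕ), i ≤ N → (reflect N r).coeff i = r.coeff (N - i) := by
    intro r N i hi
    rw [coeff_reflect, revAt_le hi]
  have h0 := congrArg (coeff · 0) h
  have h1 := congrArg (coeff · 1) h
  have h2 := congrArg (coeff · 2) h
  simp only [mul_coeff_zero, coeff_mul_one, coeff_mul_two] at h0 h1 h2
  rw [e _ _ _ (by omega), e _ _ _ (by omega), e _ _ _ (by omega)] at h0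
  rw [e _ _ _ (by omega), e _ _ _ (by omega), e _ _ _ (by omega), e _ _ _ (by omega),
    e _ _ _ (by omega)] at h1
  rw [e _ _ _ (by omega), e _ _ _ (by omega), e _ _ _ (by omega), e _ _ _ (by omega),
    e _ _ _ (by omega), e _ _ _ (by omega), e _ _ _ (by omega)] at h2
  rw [show a + b + 4 = a + 2 + (b + 2) - 0 by omega,
    show a + b + 3 = a + 2 + (b + 2) - 1 by omega,
    show a + b + 2 = a + 2 + (b + 2) - 2 by omega, h0, h1, h2]
  exact ⟨rfl, rfl, rfl⟩

end top

theorem natDegree_fibPoly_le (n : ℕ) : (fibPoly (n + 1)).natDegree ≤ n / 2 := by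
  refine natDegree_le_iff_coeff_eq_zero.2 fun j hj => ?_
  rw [coeff_fibPoly_succ, Nat.choose_eq_zero_of_lt (by omega)]; simp

theorem natDegree_pathCofactor_le (n : ℕ) (c : ℝ) :
    (pathCofactor n c).natDegree ≤ (n + 5) / 2 := by
  refine natDegree_le_iff_coeff_eq_zero.2 fun j hj => ?_
  obtain ⟨i, rfl⟩ := Nat.exists_eq_add_of_le' (show 2 ≤ j by omega)
  rw [coeff_pathCofactor, Nat.choose_eq_zero_of_lt (by omega), Nat.choose_eq_zero_of_lt (by omega)]
  simp

theorem cast_choose_five (n : ℕ) :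
    (n.choose 5 : ℝ) = n * (n - 1) * (n - 2) * (n - 3) * (n - 4) / 120 := by
  induction n with
  | zero => simp
  | succ n ih =>
    rw [Nat.choose_succ_succ, Nat.cast_add, ih, cast_choose_four]; push_cast; ring

theorem choose_top (m i : ℕ) : (m + i).choose m = (m + i).choose i :=
  Nat.choose_symm_add

/-- The inequality at the second coefficient from the top for an even path. -/
theorem path_top_even {a c : ℝ} (ha : 0 ≤ a) (hc : 0 ≤ c) (hc4 : c ≤ 4) :
    ((a + 3) * ((a + 7) * (a + 6) * (a + 5) * (a + 4) * (a + 3) / 120)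
        + (a + 4) * (a + 3) * (a + 2) / 6 * ((a + 6) * (a + 5) * (a + 4) / 6)
        + (a + 5) * (a + 4) * (a + 3) * (a + 2) * (a + 1) / 120 * (a + 5)
      - c * ((a + 3) * ((a + 4) * (a + 3) * (a + 2) * (a + 1) / 24)
        + (a + 4) * (a + 3) * (a + 2) / 6 * ((a + 3) * (a + 2) / 2)
        + (a + 5) * (a + 4) * (a + 3) * (a + 2) * (a + 1) / 120)) *
      ((a + 3) * (a + 5) + 1 - c * (a + 3)) ≤
    ((a + 3) * ((a + 6) * (a + 5) * (a + 4) / 6) + (a + 4) * (a + 3) * (a + 2) / 6 * (a + 5)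
      - c * ((a + 3) * ((a + 3) * (a + 2) / 2) + (a + 4) * (a + 3) * (a + 2) / 6)) ^ 2 := by
  refine lc_of_bernstein hc hc4 ?_ ?_ ?_ <;> · ring_nf; positivity

/-- The inequality at the coefficient next to the leading one for an odd path. -/
theorem path_top_odd {x c : ℝ} (hx : 0 ≤ x) (hc : 0 ≤ c) (hc4 : c ≤ 4) :
    ((x + 9) * (x + 8) * (x + 7) * (x + 6) / 24
        + (x + 6) * (x + 5) / 2 * ((x + 8) * (x + 7) / 2)
        + (x + 7) * (x + 6) * (x + 5) * (x + 4) / 24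
      - c * ((x + 6) * (x + 5) * (x + 4) / 6 + (x + 6) * (x + 5) / 2 * (x + 5))) *
      (1 - c * 0) ≤
    ((x + 8) * (x + 7) / 2 + (x + 6) * (x + 5) / 2 - 1 - c * (x + 5)) ^ 2 := by
  refine lc_of_bernstein hc hc4 ?_ ?_ ?_ <;> · ring_nf; positivity

/-- For an even path the monomial raises the leading coefficient. -/
theorem logConcave_path_factor_even {c : ℝ} (hc : 0 ≤ c) (hc4 : c ≤ 4) (a : ℕ) :
    LogConcave (fibPoly (2 * a + 6) * pathCofactor (2 * a + 4) c + (-X) ^ (2 * a + 6)) := by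
  have hf := logConcave_fibPoly (2 * a + 5)
  have hh := logConcave_pathCofactor hc hc4 (2 * a + 4) (Or.inr ⟨⟨a + 2, by ring⟩, by omega⟩)
  have hlc := hf.mul hh
  have hdf : (fibPoly (2 * a + 6)).natDegree ≤ a + 2 :=
    (natDegree_fibPoly_le (2 * a + 5)).trans (by omega)
  have hdh : (pathCofactor (2 * a + 4) c).natDegree ≤ a + 2 + 2 :=
    (natDegree_pathCofactor_le _ _).trans (by omega)
  obtain ⟨g0, g1, g2⟩ := coeff_mul_top hdf hdh
  have hdeg : ∀ i, 2 * a + 6 < i →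
      (fibPoly (2 * a + 6) * pathCofactor (2 * a + 4) c).coeff i = 0 := by
    intro i hi
    exact coeff_eq_zero_of_natDegree_lt (lt_of_le_of_lt (natDegree_mul_le.trans
      (Nat.add_le_add hdf hdh)) (by omega))
  have f0 : (fibPoly (2 * a + 6)).coeff (a + 2) = a + 3 := by
    rw [coeff_fibPoly_succ, show 2 * a + 5 - (a + 2) = (a + 2) + 1 by omega, choose_top]
    simp; ring
  have f1 : (fibPoly (2 * a + 6)).coeff (a + 1) = (a + 4) * (a + 3) * (a + 2) / 6 := by
    rw [coeff_fibPoly_succ, show 2 * a + 5 - (a + 1) = (a + 1) + 3 by omega, choose_top,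
      cast_choose_three]
    push_cast; ring
  have f2 : (fibPoly (2 * a + 6)).coeff a =
      (a + 5) * (a + 4) * (a + 3) * (a + 2) * (a + 1) / 120 := by
    rw [coeff_fibPoly_succ, show 2 * a + 5 - a = a + 5 by omega, choose_top, cast_choose_five]
    push_cast; ring
  have k0 : (pathCofactor (2 * a + 4) c).coeff (a + 2 + 2) = a + 5 - c := by
    rw [coeff_pathCofactor, show 2 * a + 4 + 3 - (a + 2) = (a + 2 + 2) + 1 by omega,
      show 2 * a + 4 - (a + 2) = a + 2 by omega, choose_top, Nat.choose_self]
    simp; ring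
  have k1 : (pathCofactor (2 * a + 4) c).coeff (a + 2 + 1) =
      (a + 6) * (a + 5) * (a + 4) / 6 - c * ((a + 3) * (a + 2) / 2) := by
    rw [show a + 2 + 1 = a + 1 + 2 by ring, coeff_pathCofactor,
      show 2 * a + 4 + 3 - (a + 1) = (a + 1 + 2) + 3 by omega,
      show 2 * a + 4 - (a + 1) = a + 1 + 2 by omega, choose_top, choose_top, cast_choose_three,
      Nat.cast_choose_two]
    push_cast; ring
  have k2 : (pathCofactor (2 * a + 4) c).coeff (a + 2) =
      (a + 7) * (a + 6) * (a + 5) * (a + 4) * (a + 3) / 120 -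
        c * ((a + 4) * (a + 3) * (a + 2) * (a + 1) / 24) := by
    rw [coeff_pathCofactor, show 2 * a + 4 + 3 - a = (a + 2) + 5 by omega,
      show 2 * a + 4 - a = a + 4 by omega, choose_top, choose_top, cast_choose_five,
      cast_choose_four]
    push_cast; ring
  rw [f0, k0] at g0
  rw [f0, f1, k0, k1] at g1
  rw [f0, f1, f2, k0, k1, k2] at g2
  rw [show a + (a + 2) + 4 = 2 * a + 6 by ring] at g0
  rw [show a + (a + 2) + 3 = 2 * a + 5 by ring] at g1
  rw [show a + (a + 2) + 2 = 2 * a + 4 by ring] at g2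
  rw [Even.neg_pow ⟨a + 3, by ring⟩]
  set G := fibPoly (2 * a + 6) * pathCofactor (2 * a + 4) c with hG
  have e : ∀ i, i ≠ 2 * a + 6 → (G + X ^ (2 * a + 6)).coeff i = G.coeff i := by
    intro i hi
    simp [coeff_X_pow, hi]
  have e1 : (G + X ^ (2 * a + 6)).coeff (2 * a + 6) = G.coeff (2 * a + 6) + 1 := by simp
  have ha := (Nat.cast_nonneg a : (0 : ℝ) ≤ a)
  have hpos : G.coeff (2 * a + 6) ≠ 0 := by
    rw [g0]
    have : 0 < (a : ℝ) + 5 - c := by linarith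
    positivity
  refine hlc.update (2 * a + 6) e ?_ (fun i hi h0 => ?_) (fun i hi hi2 => ?_)
  · rw [e1]; linarith [hlc.nonneg (2 * a + 6)]
  · exact hpos (hlc.zero_of_le hi.le h0)
  · by_cases hi4 : i = 2 * a + 4
    · subst hi4
      rw [e _ (by omega), e (2 * a + 4 + 1) (by omega), e1, g0, g1, g2]
      have key := path_top_even ha hc hc4
      refine le_of_eq_of_le (Eq.trans ?_ rfl) (key.trans_eq ?_) <;> ring
    · have : G.coeff (i + 2) = 0 := hdeg _ (by omega)
      rw [e (i + 2) (by omega), this, mul_zero]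
      positivity

/-- For an odd path the monomial lowers the coefficient next to the leading one. -/
theorem logConcave_path_factor_odd {c : ℝ} (hc : 0 ≤ c) (hc4 : c ≤ 4) (a : ℕ) (ha3 : 3 ≤ a) :
    LogConcave (fibPoly (2 * a + 5) * pathCofactor (2 * a + 3) c + (-X) ^ (2 * a + 5)) := by
  have hf := logConcave_fibPoly (2 * a + 4)
  have hh := logConcave_pathCofactor hc hc4 (2 * a + 3) (Or.inl (by omega))
  have hlc := hf.mul hh
  have hdf : (fibPoly (2 * a + 5)).natDegree ≤ a + 2 :=
    (natDegree_fibPoly_le (2 * a + 4)).trans (by omega)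
  have hdh : (pathCofactor (2 * a + 3) c).natDegree ≤ a + 2 + 2 :=
    (natDegree_pathCofactor_le _ _).trans (by omega)
  obtain ⟨g0, g1, g2⟩ := coeff_mul_top hdf hdh
  have hdeg : ∀ i, 2 * a + 6 < i →
      (fibPoly (2 * a + 5) * pathCofactor (2 * a + 3) c).coeff i = 0 := by
    intro i hi
    exact coeff_eq_zero_of_natDegree_lt (lt_of_le_of_lt (natDegree_mul_le.trans
      (Nat.add_le_add hdf hdh)) (by omega))
  have f0 : (fibPoly (2 * a + 5)).coeff (a + 2) = 1 := by
    rw [coeff_fibPoly_succ, show 2 * a + 4 - (a + 2) = a + 2 by omega, Nat.choose_self,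
      Nat.cast_one]
  have f1 : (fibPoly (2 * a + 5)).coeff (a + 1) = (a + 3) * (a + 2) / 2 := by
    rw [coeff_fibPoly_succ, show 2 * a + 4 - (a + 1) = (a + 1) + 2 by omega, choose_top,
      Nat.cast_choose_two]
    push_cast; ring
  have f2 : (fibPoly (2 * a + 5)).coeff a = (a + 4) * (a + 3) * (a + 2) * (a + 1) / 24 := by
    rw [coeff_fibPoly_succ, show 2 * a + 4 - a = a + 4 by omega, choose_top, cast_choose_four]
    push_cast; ring
  have k0 : (pathCofactor (2 * a + 3) c).coeff (a + 2 + 2) = 1 := by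
    rw [coeff_pathCofactor, show 2 * a + 3 + 3 - (a + 2) = a + 2 + 2 by omega,
      show 2 * a + 3 - (a + 2) = a + 1 by omega, Nat.choose_self, Nat.choose_succ_self]
    simp
  have k1 : (pathCofactor (2 * a + 3) c).coeff (a + 2 + 1) =
      (a + 5) * (a + 4) / 2 - c * (a + 2) := by
    rw [show a + 2 + 1 = a + 1 + 2 by ring, coeff_pathCofactor,
      show 2 * a + 3 + 3 - (a + 1) = (a + 1 + 2) + 2 by omega,
      show 2 * a + 3 - (a + 1) = a + 1 + 1 by omega, choose_top, choose_top, Nat.choose_one_right,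
      Nat.cast_choose_two]
    push_cast; ring
  have k2 : (pathCofactor (2 * a + 3) c).coeff (a + 2) =
      (a + 6) * (a + 5) * (a + 4) * (a + 3) / 24 - c * ((a + 3) * (a + 2) * (a + 1) / 6) := by
    rw [coeff_pathCofactor, show 2 * a + 3 + 3 - a = (a + 2) + 4 by omega,
      show 2 * a + 3 - a = a + 3 by omega, choose_top, choose_top, cast_choose_four,
      cast_choose_three]
    push_cast; ring
  rw [f0, k0] at g0
  rw [f0, f1, k0, k1] at g1
  rw [f0, f1, f2, k0, k1, k2] at g2
  rw [show a + (a + 2) + 4 = 2 * a + 6 by ring] at g0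
  rw [show a + (a + 2) + 3 = 2 * a + 5 by ring] at g1
  rw [show a + (a + 2) + 2 = 2 * a + 4 by ring] at g2
  rw [Odd.neg_pow ⟨a + 2, by ring⟩, ← sub_eq_add_neg]
  set G := fibPoly (2 * a + 5) * pathCofactor (2 * a + 3) c with hG
  have e : ∀ i, i ≠ 2 * a + 5 → (G - X ^ (2 * a + 5)).coeff i = G.coeff i := by
    intro i hi
    simp [coeff_X_pow, hi]
  have e1 : (G - X ^ (2 * a + 5)).coeff (2 * a + 5) = G.coeff (2 * a + 5) - 1 := by simp
  have ha := (Nat.cast_nonneg a : (0 : ℝ) ≤ a)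
  have hpos : 0 < G.coeff (2 * a + 5) - 1 := by
    rw [g1]
    have : 0 ≤ (4 - c) * ((a : ℝ) + 2) := mul_nonneg (by linarith) (by positivity)
    nlinarith [sq_nonneg ((a : ℝ) - 1)]
  refine hlc.update (2 * a + 5) e (by rw [e1]; exact hpos) (fun i hi h0 => ?_)
    (fun i hi hi2 => ?_)
  · have := hlc.zero_of_le hi.le h0
    rw [this] at hpos
    norm_num at hpos
  · obtain rfl | rfl | rfl : i = 2 * a + 3 ∨ i = 2 * a + 4 ∨ i = 2 * a + 5 := by omega
    · rw [e _ (by omega), e (2 * a + 3 + 1) (by omega), e1]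
      have h1 := hlc.lc (2 * a + 3)
      have h2 := hlc.nonneg (2 * a + 3)
      have : G.coeff (2 * a + 3) * (G.coeff (2 * a + 5) - 1) ≤
        G.coeff (2 * a + 3) * G.coeff (2 * a + 5) := by gcongr; linarith
      exact this.trans h1
    · rw [e _ (by omega), e (2 * a + 4 + 2) (by omega), e1, g0, g1, g2]
      obtain ⟨b, rfl⟩ := Nat.exists_eq_add_of_le' ha3
      have hb := (Nat.cast_nonneg b : (0 : ℝ) ≤ b)
      push_cast
      have key := path_top_odd hb hc hc4
      refine le_of_eq_of_le (Eq.trans ?_ rfl) (key.trans_eq ?_) <;> ring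
    · have : G.coeff (2 * a + 5 + 2) = 0 := hdeg _ (by omega)
      rw [e (2 * a + 5 + 2) (by omega), this, mul_zero]
      positivity

/-- The polynomials of the path on `k + 1` vertices satisfy the hypothesis of the factorization
argument. -/
theorem continuantLogConcave_path (k : ℕ) (hk : 1 ≤ k) : ContinuantLogConcave (fibPoly (k + 3))
    (X ^ 2 * fibPoly (k + 1) * fibPoly k) := by
  have hbase : LogConcave (fibPoly (k + 3)) := logConcave_fibPoly (k + 2)
  have hgen : ∀ c : ℝ, fibPoly (k + 3) ^ 2 - C c * (X ^ 2 * fibPoly (k + 1) * fibPoly k) =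
      fibPoly (k + 1) * pathCofactor (k - 1) c + (-X) ^ (k + 1) := by
    intro c
    rw [fibPoly_factor, pathCofactor, show k - 1 + 6 = k + 5 by omega,
      show k - 1 + 1 = k by omega]
  by_cases h2 : k = 2
  · subst h2
    refine ⟨hbase, fun c hc hc2 => ?_, fun c d hc hd hcd => ?_⟩
    · convert logConcave_path_three_factor hc hc2 using 2 <;> simp only [fibPoly] <;> ring
    · convert logConcave_path_three_factor_mul hc hd hcd using 2 <;> simp only [fibPoly] <;> ring
  by_cases h4 : k = 4
  · subst h4
    refine ⟨hbase, fun c hc hc2 => ?_, fun c d hc hd hcd => ?_⟩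
    · convert logConcave_path_five_factor hc hc2 using 2 <;> simp only [fibPoly] <;> ring
    · convert logConcave_path_five_factor_mul hc hd hcd using 2 <;> simp only [fibPoly] <;> ring
  refine ContinuantLogConcave.of_single hbase fun c hc hc4 => ?_
  obtain rfl | rfl | rfl | rfl | ⟨a, rfl⟩ | ⟨a, ha, rfl⟩ : k = 1 ∨ k = 3 ∨ k = 6 ∨ k = 8 ∨
      (∃ a, k = 2 * a + 5) ∨ ∃ a, 3 ≤ a ∧ k = 2 * a + 4 := by
    rcases Nat.even_or_odd' k with ⟨m, rfl | rfl⟩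
    · by_cases h : m < 5
      · omega
      · exact Or.inr (Or.inr (Or.inr (Or.inr (Or.inr ⟨m - 2, by omega, by omega⟩))))
    · by_cases h : m < 2
      · omega
      · exact Or.inr (Or.inr (Or.inr (Or.inr (Or.inl ⟨m - 2, by omega⟩))))
  · convert logConcave_path_two_factor hc hc4 using 2 <;> simp only [fibPoly] <;> ring
  · convert logConcave_path_four_factor hc hc4 using 2 <;> simp only [fibPoly] <;> ring
  · convert logConcave_path_seven_factor hc hc4 using 2 <;> simp only [fibPoly] <;> ring
  · convert logConcave_path_nine_factor hc hc4 using 2 <;> simp only [fibPoly] <;> ring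
  · rw [hgen]; exact logConcave_path_factor_even hc hc4 a
  · rw [hgen]; exact logConcave_path_factor_odd hc hc4 a ha

/-! ### Independence polynomials of induced subgraphs -/

section indepPoly

variable {V W : Type*}

open Classical in
/-- The independence polynomial of the subgraph of `G` induced on the finite set `S`: the sum of
`x ^ #s` over the independent sets `s ⊆ S`. The graph itself may be infinite. -/
noncomputable def indepPoly (G : SimpleGraph V) (S : Finset V) : ℝ[X] :=
  ∑ s ∈ S.powerset, if G.IsIndepSet (s : Set V) then X ^ s.card else 0

@[simp]
theorem indepPoly_empty (G : SimpleGraph V) : indepPoly G ∅ = 1 := by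
  simp [indepPoly, SimpleGraph.IsIndepSet]

open Classical in
theorem coeff_indepPoly_univ [Fintype V] (G : SimpleGraph V) (t : ℕ) :
    (indepPoly G Finset.univ).coeff t = indepSetCount G t := by
  have : ∀ s : Finset V, (if G.IsIndepSet (s : Set V) then (X : ℝ[X]) ^ s.card else 0).coeff t =
      if G.IsNIndepSet t s then 1 else 0 := by
    intro s
    by_cases h : G.IsIndepSet (s : Set V)
    · simp [SimpleGraph.isNIndepSet_iff, h, coeff_X_pow, eq_comm]
    · simp [SimpleGraph.isNIndepSet_iff, h]
  rw [indepPoly, finsetSum_coeff, Finset.sum_congr rfl fun s _ => this s, Finset.sum_boole,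
    Finset.powerset_univ]
  unfold indepSetCount
  congr 2

open Classical in
theorem indepPoly_eq_erase_add_filter (G : SimpleGraph V) {S : Finset V} {v : V} (hv : v ∈ S) :
    indepPoly G S = indepPoly G (S.erase v) +
      X * indepPoly G (S.filter fun x => x ≠ v ∧ ¬G.Adj v x) := by
  conv_lhs => rw [← Finset.insert_erase hv]
  have hv' : v ∉ S.erase v := Finset.notMem_erase v S
  rw [indepPoly, Finset.sum_powerset_insert hv']
  congr 1
  rw [indepPoly, Finset.mul_sum]
  symm
  have hsub : (S.filter fun x => x ≠ v ∧ ¬G.Adj v x) ⊆ S.erase v := by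
    intro x hx
    rw [Finset.mem_filter] at hx
    exact Finset.mem_erase.2 ⟨hx.2.1, hx.1⟩
  have : Std.Symm fun v w => ¬G.Adj v w := ⟨fun _ _ h h' => h h'.symm⟩
  have hmem : ∀ t ∈ (S.erase v).powerset, G.IsIndepSet ((insert v t : Finset V) : Set V) ↔
      (t ∈ (S.filter fun x => x ≠ v ∧ ¬G.Adj v x).powerset ∧ G.IsIndepSet (t : Set V)) := by
    intro t ht
    rw [Finset.mem_powerset] at ht
    have hvt : v ∉ t := fun h => hv' (ht h)
    rw [Finset.coe_insert, SimpleGraph.IsIndepSet, Set.pairwise_insert_of_symm_of_notMem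
      (by simpa using hvt), Finset.mem_powerset, and_comm]
    refine and_congr_left fun _ => ⟨fun h x hx => ?_, fun h x hx => ?_⟩
    · exact Finset.mem_filter.2 ⟨Finset.mem_of_mem_erase (ht hx), Finset.ne_of_mem_erase (ht hx),
        h x hx⟩
    · exact (Finset.mem_filter.1 (h hx)).2.2
  rw [← Finset.sum_subset (Finset.powerset_mono.2 hsub)]
  · refine Finset.sum_congr rfl fun t ht => ?_
    have ht' := Finset.powerset_mono.2 hsub ht
    have hvt : v ∉ t := fun h => hv' (Finset.mem_powerset.1 ht' h)
    by_cases h : G.IsIndepSet (t : Set V)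
    · rw [if_pos h, if_pos ((hmem t ht').2 ⟨ht, h⟩), Finset.card_insert_of_notMem hvt, pow_succ']
    · rw [if_neg h, if_neg fun h' => h ((hmem t ht').1 h').2, mul_zero]
  · intro t ht hnt
    rw [if_neg fun h' => hnt ((hmem t ht).1 h').1]

/-- An independent subset of `S` avoids the vertex `v`, or contains `v` and avoids its neighbours.
The two remaining sets are given by membership conditions, so that no decidability instances
are involved. -/
theorem indepPoly_delete (G : SimpleGraph V) {S S₁ S₂ : Finset V} {v : V} (hv : v ∈ S)
    (h₁ : ∀ x, x ∈ S₁ ↔ x ∈ S ∧ x ≠ v) (h₂ : ∀ x, x ∈ S₂ ↔ x ∈ S ∧ x ≠ v ∧ ¬G.Adj v x) :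
    indepPoly G S = indepPoly G S₁ + X * indepPoly G S₂ := by
  classical
  rw [indepPoly_eq_erase_add_filter G hv]
  congr 3 <;> ext x
  · rw [h₁, Finset.mem_erase, and_comm]
  · rw [h₂, Finset.mem_filter]

open Classical in
/-- An induction principle that removes a vertex, alone and together with its neighbours. -/
theorem Finset.induction_delete (G : SimpleGraph V) {P : Finset V → Prop} (h0 : P ∅)
    (h : ∀ S v, v ∈ S → P (S.erase v) → P (S.filter fun x => x ≠ v ∧ ¬G.Adj v x) → P S)
    (S : Finset V) : P S := by
  induction S using Finset.strongInduction with
  | H S ih =>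
    rcases S.eq_empty_or_nonempty with rfl | ⟨v, hv⟩
    · exact h0
    · exact h S v hv (ih _ (Finset.erase_ssubset hv))
        (ih _ ((Finset.filter_ssubset).2 ⟨v, hv, by simp⟩))

/-- The independence polynomial is multiplicative over sets with no edges between them. -/
theorem indepPoly_union (G : SimpleGraph V) {U S T : Finset V} (hU : ∀ x, x ∈ U ↔ x ∈ S ∨ x ∈ T)
    (hST : Disjoint S T) (hadj : ∀ x ∈ S, ∀ y ∈ T, ¬G.Adj x y) :
    indepPoly G U = indepPoly G S * indepPoly G T := by
  classical
  obtain rfl : U = S ∪ T := by ext x; rw [hU, Finset.mem_union]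
  clear hU
  induction T using Finset.induction_delete G with
  | h0 => simp
  | h T v hv ih₁ ih₂ =>
    have hvS : v ∉ S := Finset.disjoint_right.1 hST hv
    have hne : ∀ x ∈ S, x ≠ v := by rintro x hx rfl; exact hvS hx
    have hna : ∀ x ∈ S, ¬G.Adj v x := fun x hx h => hadj x hx v hv h.symm
    have hsub := Finset.filter_subset (fun x => x ≠ v ∧ ¬G.Adj v x) T
    rw [indepPoly_delete G hv (S₁ := T.erase v) (S₂ := T.filter fun x => x ≠ v ∧ ¬G.Adj v x)
        (by simp [and_comm]) (by simp),
      indepPoly_delete G (Finset.mem_union_right S hv) (S₁ := S ∪ T.erase v)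
        (S₂ := S ∪ T.filter fun x => x ≠ v ∧ ¬G.Adj v x) (fun x => ?_) (fun x => ?_),
      ih₁ (hST.mono_right (Finset.erase_subset v T))
        (fun x hx y hy => hadj x hx y (Finset.mem_of_mem_erase hy)),
      ih₂ (hST.mono_right hsub) (fun x hx y hy => hadj x hx y (hsub hy))]
    · ring
    · have := hne x
      simp only [Finset.mem_union, Finset.mem_erase]
      tauto
    · have := hne x
      have := hna x
      simp only [Finset.mem_union, Finset.mem_filter]
      tauto

/-- Induced subgraphs on corresponding sets have the same independence polynomial. -/
theorem indepPoly_map {G : SimpleGraph V} {H : SimpleGraph W} (f : G ↪g H) (S : Finset V) :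
    indepPoly H (S.map f.toEmbedding) = indepPoly G S := by
  classical
  induction S using Finset.induction_delete G with
  | h0 => simp
  | h S v hv ih₁ ih₂ =>
    have hf : Function.Injective f := f.injective
    rw [indepPoly_delete G hv (S₁ := S.erase v) (S₂ := S.filter fun x => x ≠ v ∧ ¬G.Adj v x)
        (by simp [and_comm]) (by simp), ← ih₁, ← ih₂]
    refine indepPoly_delete H (v := f v) (Finset.mem_map_of_mem _ hv) (fun y => ?_) (fun y => ?_)
    · simp only [Finset.mem_map, Finset.mem_erase]
      constructor
      · rintro ⟨x, ⟨hx, hxS⟩, rfl⟩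
        exact ⟨⟨x, hxS, rfl⟩, hf.ne hx⟩
      · rintro ⟨⟨x, hxS, rfl⟩, hx⟩
        exact ⟨x, ⟨fun h => hx (congrArg f h), hxS⟩, rfl⟩
    · simp only [Finset.mem_map, Finset.mem_filter]
      constructor
      · rintro ⟨x, ⟨hxS, hx, hadj⟩, rfl⟩
        exact ⟨⟨x, hxS, rfl⟩, hf.ne hx, fun h => hadj (f.map_adj_iff.1 h)⟩
      · rintro ⟨⟨x, hxS, rfl⟩, hx, hadj⟩
        exact ⟨x, ⟨hxS, fun h => hx (congrArg f h), fun h => hadj (f.map_adj_iff.2 h)⟩, rfl⟩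

theorem indepPoly_of_forall_not_adj (G : SimpleGraph V) (S : Finset V)
    (h : ∀ x ∈ S, ∀ y ∈ S, ¬G.Adj x y) : indepPoly G S = (1 + X) ^ S.card := by
  classical
  induction S using Finset.induction_on with
  | empty => simp
  | insert v S hv ih =>
    rw [indepPoly_delete G (Finset.mem_insert_self v S) (S₁ := S) (S₂ := S) (fun x => ?_)
      (fun x => ?_), ih, Finset.card_insert_of_notMem hv]
    · ring
    · exact fun x hx y hy => h x (Finset.mem_insert_of_mem hx) y (Finset.mem_insert_of_mem hy)
    · rw [Finset.mem_insert]
      have : x ∈ S → x ≠ v := by rintro hx rfl; exact hv hx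
      tauto
    · have h1 : x ∈ S → ¬G.Adj v x := fun hx =>
        h v (Finset.mem_insert_self v S) x (Finset.mem_insert_of_mem hx)
      rw [Finset.mem_insert]
      have : x ∈ S → x ≠ v := by rintro hx rfl; exact hv hx
      tauto

end indepPoly

section sequences

variable {V : Type*} [Fintype V] {G : SimpleGraph V}

theorem LogConcave.indepSeqLogConcave (h : LogConcave (indepPoly G Finset.univ)) :
    IndepSeqLogConcave G := by
  intro k hk _
  obtain ⟨k, rfl⟩ := Nat.exists_eq_add_of_le' hk
  have := h.lc k
  simp only [coeff_indepPoly_univ] at this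
  exact this

theorem LogConcave.indepSeqUnimodal (h : LogConcave (indepPoly G Finset.univ)) :
    IndepSeqUnimodal G := by
  classical
  unfold IndepSeqUnimodal UnimodalSeq
  simp only [← coeff_indepPoly_univ]
  set p := indepPoly G Finset.univ
  -- the mode is the first descent, if there is one before the end
  have hex : ∃ m, G.indepNum ≤ m ∨ p.coeff (m + 1) < p.coeff m := ⟨_, Or.inl le_rfl⟩
  refine ⟨Nat.find hex, Nat.find_min' hex (Or.inl le_rfl), fun k hk => ?_, fun k hk hkN => ?_⟩
  · have := Nat.find_min hex hk
    push Not at this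
    exact this.2
  · rcases Nat.find_spec hex with h1 | h1
    · omega
    · have h2 := h.ratio hk
      have h3 := h.nonneg (Nat.find hex + 1)
      have h4 := h.nonneg k
      refine le_of_mul_le_mul_left (a := p.coeff (Nat.find hex)) ?_ (by linarith)
      exact h2.trans (mul_le_mul_of_nonneg_right h1.le h4)

end sequences

/-! ### Independence polynomials of concatenations -/

section concatenation

variable {V : Type*}

/-- The concatenation of infinitely many copies of `G`, of which `concatenation G v w n` is the
subgraph induced on the first `n` copies. -/
def infiniteConcatenation (G : SimpleGraph V) (v w : V) : SimpleGraph (ℕ × V) where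
  Adj x y :=
    (x.1 = y.1 ∧ G.Adj x.2 y.2) ∨
    (x.1 + 1 = y.1 ∧ x.2 = w ∧ y.2 = v) ∨
    (y.1 + 1 = x.1 ∧ y.2 = w ∧ x.2 = v)
  symm := ⟨by
    rintro x y (⟨h, h'⟩ | h | h)
    · exact Or.inl ⟨h.symm, h'.symm⟩
    · exact Or.inr (Or.inr h)
    · exact Or.inr (Or.inl h)⟩
  loopless := ⟨by
    rintro x (⟨_, h⟩ | ⟨h, _⟩ | ⟨h, _⟩)
    · exact G.loopless.irrefl _ h
    · omega
    · omega⟩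

/-- The copy number `i` of `G`. -/
def copyEmbedding (G : SimpleGraph V) (v w : V) (i : ℕ) : G ↪g infiniteConcatenation G v w where
  toFun x := (i, x)
  inj' _ _ h := (Prod.mk.inj h).2
  map_rel_iff' {x y} := by
    change ((i = i ∧ G.Adj x y) ∨ (i + 1 = i ∧ _) ∨ (i + 1 = i ∧ _)) ↔ G.Adj x y
    simp

/-- The first `n` copies of `G`. -/
def initialEmbedding (G : SimpleGraph V) (v w : V) (n : ℕ) :
    concatenation G v w n ↪g infiniteConcatenation G v w where
  toFun x := (x.1.val, x.2)
  inj' x y h := Prod.ext (Fin.ext (Prod.mk.inj h).1) (Prod.mk.inj h).2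
  map_rel_iff' {x y} := by
    change ((x.1.val = y.1.val ∧ G.Adj x.2 y.2) ∨ _) ↔ ((x.1 = y.1 ∧ G.Adj x.2 y.2) ∨ _)
    rw [Fin.ext_iff]
    rfl

variable [Fintype V]

open Classical in
/-- The contribution to the independence polynomial of the sets containing `v`. -/
noncomputable def indepPolyThrough (G : SimpleGraph V) (v : V) : ℝ[X] :=
  X * indepPoly G (Finset.univ.filter fun x => x ≠ v ∧ ¬G.Adj v x)

/-- The set in the definition of `indepPolyThrough` may be given in any form. -/
theorem indepPolyThrough_eq (G : SimpleGraph V) (v : V) {S : Finset V}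
    (h : ∀ x, x ∈ S ↔ x ≠ v ∧ ¬G.Adj v x) : indepPolyThrough G v = X * indepPoly G S := by
  classical
  rw [indepPolyThrough]
  congr 2
  ext x
  simp [h]

/-- The independence polynomials of the concatenations satisfy a linear recurrence of order two:
an independent set of `n + 2` copies is a pair of independent sets of the first `n + 1` copies and
of the last one, not containing both ends of the last connecting edge; and if the set contains
`w` in copy `n`, it does not contain `v` there, so that its restriction to the first `n` copies is
arbitrary. -/
theorem indepPoly_concatenation (G : SimpleGraph V) {v w : V} (hvw : G.Adj v w) (n : ℕ) :
    indepPoly (concatenation G v w n) Finset.univ = continuantSeq (indepPoly G Finset.univ)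
      (indepPolyThrough G v * indepPolyThrough G w) n := by
  classical
  set H := infiniteConcatenation G v w with hH
  set S : ℕ → Finset (ℕ × V) := fun n => Finset.range n ×ˢ Finset.univ with hS
  have memS : ∀ n x, x ∈ S n ↔ x.1 < n := by intro n x; simp [hS]
  have hmap : indepPoly (concatenation G v w n) Finset.univ = indepPoly H (S n) := by
    rw [← indepPoly_map (initialEmbedding G v w n)]
    congr 1
    ext ⟨i, x⟩
    simp only [Finset.mem_map, Finset.mem_univ, true_and, memS]
    constructor
    · rintro ⟨y, hy⟩
      have : y.1.val = i := (Prod.mk.inj hy).1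
      exact this ▸ y.1.2
    · intro hi
      exact ⟨(⟨i, hi⟩, x), rfl⟩
  rw [hmap]
  clear hmap
  -- subsets of a single copy, and their independence polynomials
  set L : ℕ → Finset V → Finset (ℕ × V) := fun n T => T.map (copyEmbedding G v w n).toEmbedding
    with hL
  have memL : ∀ n T x, x ∈ L n T ↔ x.1 = n ∧ x.2 ∈ T := by
    rintro n T ⟨i, x⟩
    simp only [hL, Finset.mem_map]
    constructor
    · rintro ⟨y, hy, h⟩
      obtain ⟨rfl, rfl⟩ := Prod.mk.inj h
      exact ⟨rfl, hy⟩
    · rintro ⟨rfl, h⟩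
      exact ⟨x, h, rfl⟩
  have polyL : ∀ n T, indepPoly H (L n T) = indepPoly G T := fun n T =>
    indepPoly_map (copyEmbedding G v w n) T
  have hne : v ≠ w := hvw.ne
  have adj_same : ∀ i x y, H.Adj (i, x) (i, y) ↔ G.Adj x y := by
    intro i x y; simp [hH, infiniteConcatenation]
  have adj_lt : ∀ i j x y, i < j → H.Adj (i, x) (j, y) → i + 1 = j ∧ x = w ∧ y = v := by
    intro i j x y hij h
    rcases h with ⟨h, _⟩ | h | ⟨h, _⟩
    · exact absurd h hij.ne
    · exact h
    · simp only at h; omega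
  -- `S n` is far from the subsets of copy `n` avoiding `v`
  have split : ∀ n (T : Finset V) (U : Finset (ℕ × V)), v ∉ T →
      (∀ x, x ∈ U ↔ x ∈ S n ∨ x ∈ L n T) → indepPoly H U = indepPoly H (S n) * indepPoly G T := by
    intro n T U hvT hU
    rw [indepPoly_union H hU, polyL]
    · rw [Finset.disjoint_left]
      intro x hx hx'
      rw [memS] at hx
      rw [memL] at hx'
      omega
    · rintro ⟨i, x⟩ hx ⟨j, y⟩ hy hadj
      rw [memS] at hx
      rw [memL] at hy
      obtain ⟨rfl, hy⟩ := hy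
      obtain ⟨_, _, rfl⟩ := adj_lt _ _ _ _ hx hadj
      exact hvT hy
  have deleteG : ∀ u : V, indepPoly G Finset.univ =
      indepPoly G (Finset.univ.erase u) + indepPolyThrough G u := fun u =>
    indepPoly_delete G (Finset.mem_univ u) (by simp) (by simp)
  have one : indepPoly H (S 1) = indepPoly G Finset.univ := by
    rw [← polyL 0]
    congr 1
    ext x
    rw [memS, memL]
    simp
  induction n using Nat.twoStepInduction with
  | zero => simp [hS, continuantSeq]
  | one => simp [one, continuantSeq]
  | more n h0 h1 =>
    rw [continuantSeq, ← h0, ← h1]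
    -- the sets containing `w` in copy `n`
    have e1 : indepPoly H (S (n + 1)) = indepPoly H ((S (n + 1)).erase (n, w)) +
        X * indepPoly H (S n ∪ L n (Finset.univ.filter fun x => x ≠ w ∧ ¬G.Adj w x)) := by
      refine indepPoly_delete H ((memS _ _).2 (Nat.lt_succ_self n))
        (fun x => by rw [Finset.mem_erase, and_comm]) ?_
      rintro ⟨i, x⟩
      rw [Finset.mem_union, memS, memL, memS]
      simp only [Finset.mem_filter, Finset.mem_univ, true_and, ne_eq, Prod.mk.injEq]
      constructor
      · rintro (hi | ⟨rfl, hx, hadj⟩)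
        · refine ⟨by omega, by omega, fun h => ?_⟩
          exact hne (adj_lt _ _ _ _ hi h.symm).2.2.symm
        · exact ⟨by omega, by simpa using hx, by rwa [adj_same]⟩
      · rintro ⟨hi, hx, hadj⟩
        rcases Nat.lt_succ_iff_lt_or_eq.1 hi with h | h
        · exact Or.inl h
        · subst h
          exact Or.inr ⟨rfl, by simpa using hx, by rwa [adj_same] at hadj⟩
    have e2 := split n (Finset.univ.filter fun x => x ≠ w ∧ ¬G.Adj w x) _
      (by simp [hvw.symm]) (fun x => Finset.mem_union)
    -- the sets containing `v` in copy `n + 1`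
    have e3 : indepPoly H (S (n + 2)) = indepPoly H (S (n + 1) ∪ L (n + 1) (Finset.univ.erase v)) +
        X * indepPoly H ((S (n + 1)).erase (n, w) ∪
          L (n + 1) (Finset.univ.filter fun x => x ≠ v ∧ ¬G.Adj v x)) := by
      refine indepPoly_delete H (v := (n + 1, v)) ((memS _ _).2 (Nat.lt_succ_self _)) ?_ ?_
      · rintro ⟨i, x⟩
        rw [Finset.mem_union, memS, memL, memS, Finset.mem_erase]
        simp only [Finset.mem_univ, and_true, ne_eq, Prod.mk.injEq]
        constructor
        · rintro (hi | ⟨rfl, hx⟩)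
          · exact ⟨by omega, by omega⟩
          · exact ⟨by omega, by simpa using hx⟩
        · rintro ⟨hi, hx⟩
          rcases Nat.lt_succ_iff_lt_or_eq.1 hi with h | h
          · exact Or.inl h
          · subst h
            exact Or.inr ⟨rfl, by simpa using hx⟩
      · rintro ⟨i, x⟩
        rw [Finset.mem_union, Finset.mem_erase, memS, memL, memS]
        simp only [Finset.mem_filter, Finset.mem_univ, true_and, ne_eq, Prod.mk.injEq]
        constructor
        · rintro (⟨hx, hi⟩ | ⟨rfl, hx, hadj⟩)
          · refine ⟨by omega, by omega, fun h => hx ?_⟩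
            have := adj_lt _ _ _ _ hi h.symm
            exact ⟨by omega, this.2.1⟩
          · exact ⟨by omega, by simpa using hx, by rwa [adj_same]⟩
        · rintro ⟨hi, hx, hadj⟩
          rcases Nat.lt_succ_iff_lt_or_eq.1 hi with h | h
          · refine Or.inl ⟨?_, h⟩
            rintro ⟨rfl, rfl⟩
            exact hadj (by simp [hH, infiniteConcatenation])
          · subst h
            exact Or.inr ⟨rfl, by simpa using hx, by rwa [adj_same] at hadj⟩
    have e4 := split (n + 1) (Finset.univ.erase v) _ (by simp) (fun x => Finset.mem_union)
    have e5 : indepPoly H ((S (n + 1)).erase (n, w) ∪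
        L (n + 1) (Finset.univ.filter fun x => x ≠ v ∧ ¬G.Adj v x)) =
        indepPoly H ((S (n + 1)).erase (n, w)) *
          indepPoly G (Finset.univ.filter fun x => x ≠ v ∧ ¬G.Adj v x) := by
      rw [indepPoly_union H (fun x => Finset.mem_union), polyL]
      · rw [Finset.disjoint_left]
        intro x hx hx'
        have := (memS _ _).1 (Finset.mem_of_mem_erase hx)
        have := (memL _ _ _).1 hx'
        omega
      · rintro ⟨i, x⟩ hx ⟨j, y⟩ hy hadj
        obtain ⟨rfl, hy⟩ := (memL _ _ _).1 hy
        obtain ⟨_, _, rfl⟩ := adj_lt _ _ _ _ ((memS _ _).1 (Finset.mem_of_mem_erase hx)) hadj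
        simp at hy
    have hv := deleteG v
    rw [e2] at e1
    rw [e3, e4, e5]
    simp only [indepPolyThrough] at hv ⊢
    rw [hv, e1]
    ring

/-- An isomorphism of graphs induces one of their concatenations. -/
def concatenationIso {W : Type*} {G : SimpleGraph V} {G' : SimpleGraph W} (φ : G ≃g G')
    (v w : V) (n : ℕ) : concatenation G v w n ≃g concatenation G' (φ v) (φ w) n where
  toEquiv := (Equiv.refl (Fin n)).prodCongr φ.toEquiv
  map_rel_iff' {x y} := by
    simp [concatenation, φ.map_adj_iff]

theorem indepPoly_univ_congr {W : Type*} [Fintype W] {G : SimpleGraph V} {G' : SimpleGraph W}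
    (φ : G ≃g G') : indepPoly G Finset.univ = indepPoly G' Finset.univ := by
  rw [← indepPoly_map φ.toEmbedding]
  congr 1
  ext y
  simp only [Finset.mem_map, Finset.mem_univ, true_and, iff_true]
  exact ⟨φ.symm y, φ.apply_symm_apply y⟩

end concatenation

/-! ### Concatenations of double stars -/

theorem Sigma.fin_ext {m : ℕ} {k : Fin m → ℕ} {a b : Σ i : Fin m, Fin (k i)}
    (h₁ : a.1.val = b.1.val) (h₂ : a.2.val = b.2.val) : a = b := by
  obtain ⟨i, x⟩ := a
  obtain ⟨j, y⟩ := b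
  obtain rfl : i = j := Fin.ext h₁
  obtain rfl : x = y := Fin.ext h₂
  rfl

section doubleStar

variable (a b : ℕ)

theorem indepPoly_doubleStar_pendant (T : Finset (Fin a ⊕ Fin b)) :
    indepPoly (doubleStar a b) (T.map Function.Embedding.inr) = (1 + X) ^ T.card := by
  rw [indepPoly_of_forall_not_adj, Finset.card_map]
  simp [doubleStar]

theorem indepPolyThrough_doubleStar_left :
    indepPolyThrough (doubleStar a b) (.inl 0) = X * (1 + X) ^ b := by
  rw [indepPolyThrough_eq (S := (Finset.univ.map Function.Embedding.inr).map
    Function.Embedding.inr), indepPoly_doubleStar_pendant, Finset.card_map, Finset.card_univ,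
    Fintype.card_fin]
  rintro (x | x | x)
  · fin_cases x <;> simp [doubleStar]
  · simp [doubleStar]
  · simp [doubleStar]

theorem indepPolyThrough_doubleStar_right :
    indepPolyThrough (doubleStar a b) (.inl 1) = X * (1 + X) ^ a := by
  rw [indepPolyThrough_eq (S := (Finset.univ.map Function.Embedding.inl).map
    Function.Embedding.inr), indepPoly_doubleStar_pendant, Finset.card_map, Finset.card_univ,
    Fintype.card_fin]
  rintro (x | x | x)
  · fin_cases x <;> simp [doubleStar]
  · simp [doubleStar]
  · simp [doubleStar]

theorem indepPoly_doubleStar : indepPoly (doubleStar a b) Finset.univ =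
    (1 + X) ^ (a + b) + X * (1 + X) ^ b + X * (1 + X) ^ a := by
  rw [indepPoly_delete (doubleStar a b) (Finset.mem_univ (.inl 0))
    (S₁ := Finset.univ.erase (.inl 0))
    (S₂ := (Finset.univ.map Function.Embedding.inr).map Function.Embedding.inr) (by simp) ?_,
    indepPoly_delete (doubleStar a b) (v := .inl 1) (S := Finset.univ.erase (.inl 0))
    (S₁ := Finset.univ.map Function.Embedding.inr)
    (S₂ := (Finset.univ.map Function.Embedding.inl).map Function.Embedding.inr) (by simp) ?_ ?_,
    indepPoly_doubleStar_pendant, indepPoly_doubleStar_pendant, indepPoly_doubleStar_pendant]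
  · simp only [Finset.card_map, Finset.card_univ, Fintype.card_sum, Fintype.card_fin]
    ring
  · rintro (x | x)
    · fin_cases x <;> simp
    · simp
  · rintro (x | x | x)
    · fin_cases x <;> simp [doubleStar]
    · simp [doubleStar]
    · simp [doubleStar]
  · rintro (x | x | x)
    · fin_cases x <;> simp [doubleStar]
    · simp [doubleStar]
    · simp [doubleStar]

theorem doubleStar_adj : (doubleStar a b).Adj (.inl 0) (.inl 1) := by simp [doubleStar]

theorem logConcave_concatenation_doubleStar (n : ℕ) : LogConcave
    (indepPoly (concatenation (doubleStar a b) (.inl 0) (.inl 1) n) Finset.univ) := by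
  rw [indepPoly_concatenation _ (doubleStar_adj a b), indepPolyThrough_doubleStar_left,
    indepPolyThrough_doubleStar_right, indepPoly_doubleStar]
  refine ContinuantLogConcave.logConcave ?_ (fun x hx => ?_) n
  · rcases le_total a b with h | h
    · obtain ⟨d, rfl⟩ := Nat.exists_eq_add_of_le h
      exact continuantLogConcave_doubleStar a d
    · obtain ⟨d, rfl⟩ := Nat.exists_eq_add_of_le h
      convert continuantLogConcave_doubleStar b d using 1 <;> ring
  · simp only [eval_mul, eval_X, eval_pow, eval_add, eval_one]
    positivity

/-- The vertex of the caterpillar corresponding to a vertex of the concatenation. -/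
def doubleStarToCaterpillar (n : ℕ) : Fin n × (Fin 2 ⊕ (Fin a ⊕ Fin b)) →
    Fin (2 * n) ⊕ (Σ i : Fin (2 * n), Fin (if Even i.val then a else b))
  | (i, .inl 0) => .inl ⟨2 * i.val, by omega⟩
  | (i, .inl 1) => .inl ⟨2 * i.val + 1, by omega⟩
  | (i, .inr (.inl j)) => .inr ⟨⟨2 * i.val, by omega⟩, j.val, by simp⟩
  | (i, .inr (.inr j)) => .inr ⟨⟨2 * i.val + 1, by omega⟩, j.val, by simp⟩

theorem doubleStarToCaterpillar_bijective (n : ℕ) :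
    Function.Bijective (doubleStarToCaterpillar a b n) := by
  constructor
  · have key : ∀ x y : Σ i : Fin (2 * n), Fin (if Even i.val then a else b),
        x = y → x.1.val = y.1.val ∧ x.2.val = y.2.val := by rintro x _ rfl; exact ⟨rfl, rfl⟩
    rintro ⟨i, x | x | x⟩ ⟨j, y | y | y⟩ h
    · fin_cases x <;> fin_cases y <;>
      · simp only [doubleStarToCaterpillar, Sum.inl.injEq, Fin.mk.injEq] at h
        first
        | omega
        | (obtain rfl : i = j := Fin.ext (by omega); rfl)
    · fin_cases x <;> simp [doubleStarToCaterpillar] at h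
    · fin_cases x <;> simp [doubleStarToCaterpillar] at h
    · fin_cases y <;> simp [doubleStarToCaterpillar] at h
    · have := key _ _ (Sum.inr_injective h)
      simp only at this
      obtain rfl : i = j := Fin.ext (by omega)
      obtain rfl : x = y := Fin.ext this.2
      rfl
    · have := key _ _ (Sum.inr_injective h)
      simp only at this
      omega
    · fin_cases y <;> simp [doubleStarToCaterpillar] at h
    · have := key _ _ (Sum.inr_injective h)
      simp only at this
      omega
    · have := key _ _ (Sum.inr_injective h)
      simp only at this
      obtain rfl : i = j := Fin.ext (by omega)
      obtain rfl : x = y := Fin.ext this.2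
      rfl
  · rintro (m | ⟨m, j⟩)
    · rcases Nat.even_or_odd' m.val with ⟨i, hi | hi⟩
      · exact ⟨(⟨i, by omega⟩, .inl 0), congrArg Sum.inl (Fin.ext hi.symm)⟩
      · exact ⟨(⟨i, by omega⟩, .inl 1), congrArg Sum.inl (Fin.ext hi.symm)⟩
    · rcases Nat.even_or_odd' m.val with ⟨i, hi | hi⟩
      · have hj : j.val < a := j.2.trans_eq (if_pos ⟨i, by omega⟩)
        exact ⟨(⟨i, by omega⟩, .inr (.inl ⟨j, hj⟩)),
          congrArg Sum.inr (Sigma.fin_ext hi.symm rfl)⟩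
      · have hj : j.val < b := j.2.trans_eq (if_neg (Nat.not_even_iff_odd.2 ⟨i, hi⟩))
        exact ⟨(⟨i, by omega⟩, .inr (.inr ⟨j, hj⟩)),
          congrArg Sum.inr (Sigma.fin_ext hi.symm rfl)⟩

theorem doubleStarToCaterpillar_adj (n : ℕ) (x y : Fin n × (Fin 2 ⊕ (Fin a ⊕ Fin b))) :
    (caterpillar (2 * n) fun i => if Even i.val then a else b).Adj
      (doubleStarToCaterpillar a b n x) (doubleStarToCaterpillar a b n y) ↔
    (concatenation (doubleStar a b) (.inl 0) (.inl 1) n).Adj x y := by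
  obtain ⟨⟨i, hi⟩, x | x | x⟩ := x <;> obtain ⟨⟨j, hj⟩, y | y | y⟩ := y <;>
  (try fin_cases x) <;> (try fin_cases y) <;>
  simp [caterpillar, concatenation, doubleStar, doubleStarToCaterpillar] <;> omega

end doubleStar

/-! ### Concatenations of paths -/

section path

/-- Stated with truncated subtraction in order to include `F_1 = 1` for the empty path. -/
theorem indepPoly_hasse_Ico (m a : ℕ) :
    indepPoly (SimpleGraph.hasse ℕ) (Finset.Ico a (a + m - 1)) = fibPoly (m + 1) := by
  induction m using Nat.twoStepInduction generalizing a with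
  | zero => simp [fibPoly]
  | one => simp [fibPoly]
  | more m h0 h1 =>
    rw [indepPoly_delete _ (v := a) (S₁ := Finset.Ico (a + 1) (a + 1 + (m + 1) - 1))
      (S₂ := Finset.Ico (a + 2) (a + 2 + m - 1)) ?_ ?_ ?_, h0, h1, fibPoly_add_two (m + 1)]
    · rw [Finset.mem_Ico]; omega
    · intro x
      rw [Finset.mem_Ico, Finset.mem_Ico]; omega
    · intro x
      rw [Finset.mem_Ico, Finset.mem_Ico, SimpleGraph.hasse_adj, Nat.covBy_iff_add_one_eq,
        Nat.covBy_iff_add_one_eq]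
      omega

/-- The inclusion of a finite path in the infinite one. -/
def pathEmbedding (k : ℕ) : SimpleGraph.pathGraph k ↪g SimpleGraph.hasse ℕ where
  toFun := Fin.val
  inj' := Fin.val_injective
  map_rel_iff' {x y} := by
    rw [SimpleGraph.pathGraph_adj]
    change (SimpleGraph.hasse ℕ).Adj x.val y.val ↔ _
    rw [SimpleGraph.hasse_adj, Nat.covBy_iff_add_one_eq, Nat.covBy_iff_add_one_eq]

theorem indepPoly_pathGraph_of_mem_iff {k m a : ℕ} (T : Finset (Fin k)) (ha : a + m = k + 1)
    (hT : ∀ x, x ∈ T ↔ a ≤ x.val) : indepPoly (SimpleGraph.pathGraph k) T = fibPoly (m + 1) := by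
  rw [← indepPoly_hasse_Ico m a, ← indepPoly_map (pathEmbedding k)]
  congr 1
  ext y
  rw [Finset.mem_map, Finset.mem_Ico]
  constructor
  · rintro ⟨x, hx, rfl⟩
    rw [hT] at hx
    have := x.2
    change a ≤ x.val ∧ x.val < a + m - 1
    omega
  · intro hy
    exact ⟨⟨y, by omega⟩, (hT _).2 hy.1, rfl⟩

theorem logConcave_concatenation_pathGraph {k : ℕ} {v w : Fin k} (hv : v.val = 1)
    (hw : w.val = 0) (n : ℕ) : LogConcave
      (indepPoly (concatenation (SimpleGraph.pathGraph k) v w n) Finset.univ) := by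
  obtain ⟨k, rfl⟩ : ∃ j, k = j + 2 := ⟨k - 2, by omega⟩
  have hvw : (SimpleGraph.pathGraph (k + 2)).Adj v w := by
    rw [SimpleGraph.pathGraph_adj]; omega
  have e0 : indepPoly (SimpleGraph.pathGraph (k + 2)) Finset.univ = fibPoly (k + 1 + 3) :=
    indepPoly_pathGraph_of_mem_iff (a := 0) (m := k + 3) _ (by ring) (by simp)
  have ew : indepPolyThrough (SimpleGraph.pathGraph (k + 2)) w = X * fibPoly (k + 1 + 1) := by
    rw [indepPolyThrough_eq (S := Finset.univ.filter fun x => 2 ≤ x.val)]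
    · rw [indepPoly_pathGraph_of_mem_iff (a := 2) (m := k + 1) _ (by ring) (by simp)]
    · intro x
      simp only [Finset.mem_filter, Finset.mem_univ, true_and, SimpleGraph.pathGraph_adj, ne_eq,
        Fin.ext_iff]
      omega
  have ev : indepPolyThrough (SimpleGraph.pathGraph (k + 2)) v = X * fibPoly (k + 1) := by
    rw [indepPolyThrough_eq (S := Finset.univ.filter fun x => 3 ≤ x.val)]
    · rw [indepPoly_pathGraph_of_mem_iff (a := 3) (m := k) _ (by ring) (by simp)]
    · intro x
      simp only [Finset.mem_filter, Finset.mem_univ, true_and, SimpleGraph.pathGraph_adj, ne_eq,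
        Fin.ext_iff]
      omega
  have hpos : ∀ (m : ℕ) (x : ℝ), 0 < x → 0 < (fibPoly (m + 1)).eval x := by
    intro m x hx
    induction m using Nat.twoStepInduction with
    | zero => simp [fibPoly]
    | one => simp [fibPoly]
    | more m h0 h1 =>
      rw [fibPoly_add_two, eval_add, eval_mul, eval_X]
      positivity
  rw [indepPoly_concatenation _ hvw, e0, ew, ev]
  have hq : X * fibPoly (k + 1) * (X * fibPoly (k + 1 + 1)) =
      X ^ 2 * fibPoly (k + 1 + 1) * fibPoly (k + 1) := by ring
  rw [hq]
  refine (continuantLogConcave_path (k + 1) (by omega)).logConcave (fun x hx => ?_) n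
  rw [eval_mul, eval_mul, eval_pow, eval_X]
  have := hpos k x hx
  have := hpos (k + 1) x hx
  positivity

/-- The reversal of a path. -/
def pathGraphRev (k : ℕ) : SimpleGraph.pathGraph k ≃g SimpleGraph.pathGraph k where
  toEquiv := Fin.revPerm
  map_rel_iff' {x y} := by
    simp only [SimpleGraph.pathGraph_adj, Fin.revPerm_apply, Fin.val_rev]
    omega

/-- A leaf of a path with its neighbour can be moved to the beginning of the path. -/
theorem exists_pathGraph_iso {k : ℕ} {v w : Fin k}
    (h : (SimpleGraph.pathGraph k).neighborSet w = {v}) :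
    ∃ φ : SimpleGraph.pathGraph k ≃g SimpleGraph.pathGraph k,
      (φ v).val = 1 ∧ (φ w).val = 0 := by
  have hmem : ∀ x : Fin k, (w.val + 1 = x.val ∨ x.val + 1 = w.val) ↔ x = v := by
    intro x
    rw [← SimpleGraph.pathGraph_adj, ← SimpleGraph.mem_neighborSet, h, Set.mem_singleton_iff]
  have hv := (hmem v).2 rfl
  have hv2 := v.2
  have hw2 := w.2
  rcases hv with hv | hv
  · have hw : w.val = 0 := by
      by_contra hne
      have := congrArg Fin.val ((hmem ⟨w.val - 1, by omega⟩).1 (Or.inr (by simp; omega)))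
      simp only at this
      omega
    exact ⟨SimpleGraph.Iso.refl, by simp; omega, by simpa using hw⟩
  · have hw : w.val + 1 = k := by
      by_contra hne
      have := congrArg Fin.val ((hmem ⟨w.val + 1, by omega⟩).1 (Or.inl rfl))
      simp only at this
      omega
    refine ⟨pathGraphRev k, ?_, ?_⟩
    · change (Fin.rev v).val = 1
      rw [Fin.val_rev]; omega
    · change (Fin.rev w).val = 0
      rw [Fin.val_rev]; omega

/-- The vertex of the path with pendant paths corresponding to a vertex of the concatenation of
paths, whose connecting vertices are the first two in each copy: the first vertex of a copy lies on
the spine, and the others form a pendant path together with the preceding spine vertex. -/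
def pathToPendantPaths (k n : ℕ) (p : Fin n × Fin k) :
    Σ i : Fin (2 * n), Fin ((if Even i.val then k - 2 else 0) + 1) :=
  ⟨⟨2 * p.1.val + (if p.2.val = 0 then 1 else 0), by split_ifs <;> omega⟩, p.2.val - 1, by
    have := p.2.2
    by_cases h : p.2.val = 0
    · rw [h]; omega
    · simp only [h, if_false, add_zero, even_two_mul, if_true]; omega⟩

theorem pathToPendantPaths_bijective {k : ℕ} (hk : 2 ≤ k) (n : ℕ) :
    Function.Bijective (pathToPendantPaths k n) := by
  constructor
  · rintro ⟨i, x⟩ ⟨j, y⟩ h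
    have h1 := congrArg (fun z => z.1.val) h
    have h2 := congrArg (fun z => z.2.val) h
    simp only [pathToPendantPaths] at h1 h2
    have : i.val = j.val ∧ x.val = y.val := by split_ifs at h1 <;> omega
    exact Prod.ext (Fin.ext this.1) (Fin.ext this.2)
  · rintro ⟨m, j⟩
    rcases Nat.even_or_odd' m.val with ⟨i, hi | hi⟩
    · have hj : j.val < k - 2 + 1 :=
        j.2.trans_eq (congrArg (· + 1) (if_pos ⟨i, by omega⟩))
      exact ⟨(⟨i, by omega⟩, ⟨j.val + 1, by omega⟩), Sigma.fin_ext (by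
        simp [pathToPendantPaths, hi]) (by simp [pathToPendantPaths])⟩
    · have hj : j.val < 0 + 1 :=
        j.2.trans_eq (congrArg (· + 1) (if_neg (Nat.not_even_iff_odd.2 ⟨i, hi⟩)))
      exact ⟨(⟨i, by omega⟩, ⟨0, by omega⟩), Sigma.fin_ext (by
        simp [pathToPendantPaths, hi]) (by simp [pathToPendantPaths]; omega)⟩

theorem pathToPendantPaths_adj {k : ℕ} {v w : Fin k} (hv : v.val = 1) (hw : w.val = 0) (n : ℕ)
    (x y : Fin n × Fin k) :
    (pathWithPendantPaths (2 * n) fun i => if Even i.val then k - 2 else 0).Adj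
      (pathToPendantPaths k n x) (pathToPendantPaths k n y) ↔
    (concatenation (SimpleGraph.pathGraph k) v w n).Adj x y := by
  have hinj := (pathToPendantPaths_bijective (k := k) (by omega) n).1
  obtain ⟨⟨i, hi⟩, ⟨x, hx⟩⟩ := x
  obtain ⟨⟨j, hj⟩, ⟨y, hy⟩⟩ := y
  rw [pathWithPendantPaths, SimpleGraph.fromRel_adj, hinj.ne_iff]
  simp only [pathToPendantPaths, concatenation, SimpleGraph.pathGraph_adj, ne_eq, Prod.mk.injEq,
    Fin.ext_iff, hv, hw]
  split_ifs <;> omega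

end path

theorem theorem1p8 :
    (∀ ℓ₁ ℓ₂ n : ℕ,
      IndepSeqLogConcave (concatenation (doubleStar ℓ₁ ℓ₂) (.inl 0) (.inl 1) n) ∧
      IndepSeqUnimodal (concatenation (doubleStar ℓ₁ ℓ₂) (.inl 0) (.inl 1) n) ∧
      Nonempty (concatenation (doubleStar ℓ₁ ℓ₂) (.inl 0) (.inl 1) n ≃g
        caterpillar (2 * n) (fun i => if Even i.val then ℓ₁ else ℓ₂))) ∧
    (∀ k : ℕ, 1 ≤ k → k ≤ 5000 → ∀ v w : Fin k,
      (SimpleGraph.pathGraph k).neighborSet w = {v} → ∀ n : ℕ,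
        IndepSeqLogConcave (concatenation (SimpleGraph.pathGraph k) v w n) ∧
        IndepSeqUnimodal (concatenation (SimpleGraph.pathGraph k) v w n) ∧
        Nonempty (concatenation (SimpleGraph.pathGraph k) v w n ≃g
          pathWithPendantPaths (2 * n) (fun i => if Even i.val then k - 2 else 0))) := by
  refine ⟨fun ℓ₁ ℓ₂ n => ?_, fun k _ _ v w hvw n => ?_⟩
  · have h := logConcave_concatenation_doubleStar ℓ₁ ℓ₂ n
    exact ⟨h.indepSeqLogConcave, h.indepSeqUnimodal,
      ⟨⟨Equiv.ofBijective _ (doubleStarToCaterpillar_bijective ℓ₁ ℓ₂ n),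
        doubleStarToCaterpillar_adj ℓ₁ ℓ₂ n _ _⟩⟩⟩
  · obtain ⟨φ, hv, hw⟩ := exists_pathGraph_iso hvw
    have e := concatenationIso φ v w n
    have h := logConcave_concatenation_pathGraph hv hw n
    rw [← indepPoly_univ_congr e] at h
    refine ⟨h.indepSeqLogConcave, h.indepSeqUnimodal, ⟨e.trans ?_⟩⟩
    exact ⟨Equiv.ofBijective _ (pathToPendantPaths_bijective (by omega) n),
      pathToPendantPaths_adj hv hw n _ _⟩
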